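/- Let $\gamma\subset\mathbb C$ be a finite union of piecewise smooth oriented curves (bounded or unbounded), let $r,N\ge 1$, and let $W$ be an $r\times r$ matrix of rational functions with no pole on $\gamma$. Write $\mathcal P_{m}$ for the polynomials of degree $\le m$. Given a contour $\Gamma$ and a matrix weight $w$ of size $k\times k$ on it, a \emph{CD kernel} of size $n$ is a $k\times k$ matrix polynomial $\mathcal R(x,y)$, of degree $\le n-1$ in both $x$ and $y$, such that either $\int_\Gamma P(x)w(x)\mathcal R(x,y)\,dx=P(y)$ for all $P\in\mathcal P_{n-1}^{k\times k}$ and $y\in\mathbb C$, or $\int_\Gamma \mathcal R(x,y)w(y)P(y)\,dy=P(x)$ for all $P\in\mathcal P_{n-1}^{k\times k}$ and $x\in\mathbb C$ (the convergence of the integrals being part of the definition). Suppose that a CD kernel $\mathcal R_N^W$ of size $N$ for $W$ on $\gamma$ exists. Suppose that for all but finitely many $z\in\mathbb C$ we have $W(z)=E(z)\,\mathrm{diag}(\lambda_1(z),\dots,\lambda_r(z))\,E(z)^{-1}$ with $E(z)$ invertible. Let $\mathcal M$ be an $r$-sheeted Riemann surface over $\widehat{\mathbb C}=\mathbb C\cup\{\infty\}$: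 a Riemann surface with a holomorphic projection $\pi:\mathcal M\to\widehat{\mathbb C}$ and, for each $z\in\widehat{\mathbb C}$, a numbering $z^{(1)},\dots,z^{(r)}$ of the points over $z$, each repeated according to its ramification index. Suppose that $\lambda:\mathcal M\to\widehat{\mathbb C}$, $\mathfrak e$ (with values in columns of length $r$) and $\mathfrak e^{-1}$ (with values in rows of length $r$) are meromorphic on $\mathcal M$ and that, for all but finitely many $z$ and all $k$, $\lambda(z^{(k)})=\lambda_k(z)$, $\mathfrak e(z^{(k)})$ is the $k$-th column of $E(z)$ and $\mathfrak e^{-1}(z^{(k)})$ is the $k$-th row of $E(z)^{-1}$. Suppose that $\mathcal M$ is connected and of genus $0$, and let $\varphi:\widehat{\mathbb C}\to\mathcal M$ be biholomorphic; put $\phi=\pi\circ\varphi$. Let $n_p$ (resp. $\widehat n_p$) be the order at $p\in\mathcal M$ of $\mathfrak e$ (resp. $\mathfrak e^{-1}$), that is, the minimum of the orders of the entries, and let $\mathcal S$ (resp. $\widehat{\mathcal S}$) be the finite set of $p$ where it is nonzero. Define $$h(\zeta)=\prod_{j:\ \infty^{(j)}\ne\varphi(\infty)}\bigl(\zeta-\varphi^{-1}(\infty^{(j)})\bigr)^{N-1}\prod_{p\in\mathcal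 S\setminus\{\varphi(\infty)\}}\bigl(\zeta-\varphi^{-1}(p)\bigr)^{-n_p},$$ and $\widehat h$ in the same way with $\widehat{\mathcal S},\widehat n_p$ in place of $\mathcal S,n_p$. Let $$L_N=\{p\mapsto P(\pi(p))\,\mathfrak e(p):P\in\mathcal P_{N-1}^{1\times r}\},\qquad L_N^*=\{p\mapsto \mathfrak e^{-1}(p)P(\pi(p)):P\in\mathcal P_{N-1}^{r\times1}\},$$ $$\mathcal V=\{(f\circ\varphi)\,h:f\in L_N\},\qquad \mathcal V^*=\{(f\circ\varphi)\,\widehat h:f\in L_N^*\},$$ $$\mathcal W(\omega)=\frac{\lambda(\varphi(\omega))}{h(\omega)\widehat h(\omega)}\,\phi'(\omega),\qquad \mathfrak R(\omega,\zeta)=\widehat h(\omega)\,\mathfrak e^{-1}(\varphi(\omega))\,\mathcal R_N^W(\phi(\omega),\phi(\zeta))\,\mathfrak e(\varphi(\zeta))\,h(\zeta).$$ Let $\gamma_{\mathcal M}$ be the contour on $\mathcal M$ consisting of the $r$ copies of $\gamma$, one on each sheet (parametrized by continuous lifts of $\gamma$ which at each time list the points of $\mathcal M$ over that point of $\gamma$,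 with multiplicity), and $\gamma_{\mathbb C}=\varphi^{-1}(\gamma_{\mathcal M})$. In integrals over $\gamma_{\mathbb C}$ the contributions of the $r$ lifts at the same time are added before integrating over the time parameter; this is the sum of the integrals along the lifts whenever those converge. Then the elements of $\mathcal V$ and $\mathcal V^*$ are polynomials, $\mathfrak R$ extends to a unique polynomial in $(\omega,\zeta)$, $\dim\mathcal V=\dim\mathcal V^*=rN$, and: (a) $\mathfrak R(\omega,\cdot)\in\mathcal V$ for every $\omega\in\mathbb C$; (b) $\mathfrak R(\cdot,\zeta)\in\mathcal V^*$ for every $\zeta\in\mathbb C$; (c) $\int_{\gamma_{\mathbb C}}p(\omega)\mathcal W(\omega)\mathfrak R(\omega,\zeta)\,d\omega=p(\zeta)$ for all $p\in\mathcal V$, $\zeta\in\mathbb C$; (d) $\int_{\gamma_{\mathbb C}}\mathfrak R(\omega,\zeta)\mathcal W(\zeta)p(\zeta)\,d\zeta=p(\omega)$ for all $p\in\mathcal V^*$, $\omega\in\mathbb C$; (e) the following are equivalent: $-\sum_{p\in\mathcal S}n_p=r-1$; $-\sum_{p\in\widehat{\mathcal S}}\widehat n_p=r-1$; $\mathcal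 V=\mathcal P_{rN-1}$; $\mathcal V^*=\mathcal P_{rN-1}$; $\mathfrak R$ is the scalar CD kernel of size $rN$ for the weight $\mathcal W$ on $\gamma_{\mathbb C}$. -/

import Mathlib

open scoped Manifold Polynomial Topology OnePoint

noncomputable section

namespace RiemannSphere

open OnePoint

/-- The affine coordinate of a point of the Riemann sphere `ℂ ∪ {∞}` (with the convention `0` at
`∞`). -/
def coord (x : OnePoint ℂ) : ℂ := x.elim 0 id

@[simp] theorem coord_coe (z : ℂ) : coord (z : OnePoint ℂ) = z := rfl

@[simp] theorem coord_infty : coord (∞ : OnePoint ℂ) = 0 := rfl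

/-- The chart `z ↦ z` on `ℂ ∪ {∞} \ {∞}`. -/
def affineChart : OpenPartialHomeomorph (OnePoint ℂ) ℂ where
  toFun := coord
  invFun := fun z => (z : OnePoint ℂ)
  source := {∞}ᶜ
  target := Set.univ
  map_source' := fun _ _ => Set.mem_univ _
  map_target' := fun z _ => by simp
  left_inv' := fun x hx => by
    induction x using OnePoint.rec with
    | infty => simp at hx
    | coe z => rfl
  right_inv' := fun _ _ => rfl
  open_source := isOpen_compl_singleton
  open_target := isOpen_univ
  continuousOn_toFun := fun x hx => by
    induction x using OnePoint.rec with
    | infty => simp at hx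
    | coe z =>
      have h : ContinuousAt (coord ∘ fun w : ℂ => (w : OnePoint ℂ)) z := continuousAt_id
      exact (OnePoint.continuousAt_coe.2 h).continuousWithinAt
  continuousOn_invFun := OnePoint.continuous_coe.continuousOn

/-- The inversion `z ↦ 1 / z` of the Riemann sphere. -/
def invFun (x : OnePoint ℂ) : OnePoint ℂ :=
  open Classical in x.elim ((0 : ℂ) : OnePoint ℂ) fun z => if z = 0 then ∞ else ((z⁻¹ : ℂ) : OnePoint ℂ)

theorem invFun_infty : invFun ∞ = ((0 : ℂ) : OnePoint ℂ) := rfl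

theorem invFun_zero : invFun ((0 : ℂ) : OnePoint ℂ) = ∞ := by simp [invFun]

theorem invFun_coe {z : ℂ} (hz : z ≠ 0) : invFun (z : OnePoint ℂ) = ((z⁻¹ : ℂ) : OnePoint ℂ) := by
  simp [invFun, hz]

theorem invFun_invFun (x : OnePoint ℂ) : invFun (invFun x) = x := by
  induction x using OnePoint.rec with
  | infty => rw [invFun_infty, invFun_zero]
  | coe z =>
    by_cases hz : z = 0
    · rw [hz, invFun_zero, invFun_infty]
    · rw [invFun_coe hz, invFun_coe (inv_ne_zero hz), inv_inv]

theorem continuous_invFun : Continuous invFun := by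
  rw [continuous_iff_continuousAt]
  intro x
  induction x using OnePoint.rec with
  | infty =>
    rw [OnePoint.continuousAt_infty', invFun_infty, Filter.coclosedCompact_eq_cocompact]
    have h1 : Filter.Tendsto (fun z : ℂ => ((z⁻¹ : ℂ) : OnePoint ℂ)) (Filter.cocompact ℂ)
        (𝓝 ((0 : ℂ) : OnePoint ℂ)) :=
      (OnePoint.continuous_coe.tendsto (0 : ℂ)).comp (Filter.tendsto_inv₀_cobounded.mono_left
        (Metric.cobounded_eq_cocompact (α := ℂ)).ge)
    refine h1.congr' ?_
    have : ({0}ᶜ : Set ℂ) ∈ Filter.cocompact ℂ := (isCompact_singleton).compl_mem_cocompact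
    filter_upwards [this] with z hz
    exact (invFun_coe hz).symm
  | coe z =>
    rw [OnePoint.continuousAt_coe]
    by_cases hz : z = 0
    · subst hz
      rw [ContinuousAt, Function.comp_apply, invFun_zero]
      have h1 : Filter.Tendsto (fun z : ℂ => ((z⁻¹ : ℂ) : OnePoint ℂ)) (𝓝[≠] 0) (𝓝 ∞) := by
        refine Filter.Tendsto.comp (y := Filter.cocompact ℂ) ?_ ?_
        · rw [← Filter.coclosedCompact_eq_cocompact]
          exact OnePoint.tendsto_coe_infty
        · rw [← Metric.cobounded_eq_cocompact]
          exact Filter.tendsto_inv₀_nhdsNE_zero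
      rw [← nhdsNE_sup_pure, Filter.tendsto_sup]
      refine ⟨h1.congr' ?_, ?_⟩
      · filter_upwards [self_mem_nhdsWithin] with z hz
        exact (invFun_coe hz).symm
      · rw [Filter.tendsto_pure_left]
        intro s hs
        simpa [invFun_zero] using mem_of_mem_nhds hs
    · have h1 : ContinuousAt (fun z : ℂ => ((z⁻¹ : ℂ) : OnePoint ℂ)) z :=
        OnePoint.continuous_coe.continuousAt.comp (continuousAt_inv₀ hz)
      refine h1.congr ?_
      filter_upwards [isOpen_ne.mem_nhds hz] with w hw
      exact (invFun_coe hw).symm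

/-- The inversion as a homeomorphism. -/
def inversion : OnePoint ℂ ≃ₜ OnePoint ℂ where
  toFun := invFun
  invFun := invFun
  left_inv := invFun_invFun
  right_inv := invFun_invFun
  continuous_toFun := continuous_invFun
  continuous_invFun := continuous_invFun

/-- The chart `z ↦ 1 / z` on `ℂ ∪ {∞} \ {0}`. -/
def inftyChart : OpenPartialHomeomorph (OnePoint ℂ) ℂ :=
  inversion.transOpenPartialHomeomorph affineChart

/-- The standard holomorphic atlas of the Riemann sphere. -/
instance : ChartedSpace ℂ (OnePoint ℂ) where
  atlas := {affineChart, inftyChart}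
  chartAt := fun x => open Classical in if x = ∞ then inftyChart else affineChart
  mem_chart_source := fun x => by
    by_cases hx : x = ∞
    · subst hx
      simp [inftyChart, affineChart, inversion, invFun_infty]
    · simp [hx, affineChart]
  chart_mem_atlas := fun x => by
    by_cases hx : x = ∞ <;> simp [hx]

theorem contDiffOn_inv_ne_zero : ContDiffOn ℂ ⊤ (fun z : ℂ => z⁻¹) {z | z ≠ 0} :=
  fun _ hz => (contDiffAt_inv ℂ hz).contDiffWithinAt

instance : IsManifold 𝓘(ℂ) ⊤ (OnePoint ℂ) := by
  refine isManifold_of_contDiffOn _ _ _ ?_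
  have hself : ∀ e : OpenPartialHomeomorph (OnePoint ℂ) ℂ,
      ContDiffOn ℂ ⊤ (e ∘ e.symm) e.target := fun e =>
    contDiffOn_id.congr fun z hz => e.right_inv hz
  have h12 : ∀ z : ℂ, z ≠ 0 → inftyChart (affineChart.symm z) = z⁻¹ := fun z hz => by
    change coord (invFun (z : OnePoint ℂ)) = _
    rw [invFun_coe hz, coord_coe]
  have h21 : ∀ z : ℂ, z ≠ 0 → affineChart (inftyChart.symm z) = z⁻¹ := h12
  have e1 : ∀ z : ℂ, affineChart.symm z ∈ inftyChart.source → z ≠ 0 := by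
    rintro z hz rfl
    exact hz invFun_zero
  have e2 : ∀ z : ℂ, inftyChart.symm z ∈ affineChart.source → z ≠ 0 := e1
  rintro e e' (rfl | rfl) (rfl | rfl)
  · simpa using (hself affineChart).mono (by intro z hz; exact Set.mem_univ _)
  · refine (contDiffOn_inv_ne_zero.mono fun z hz => ?_).congr fun z hz => ?_
    · exact e1 z hz.1.2
    · simpa using h12 z (e1 z hz.1.2)
  · refine (contDiffOn_inv_ne_zero.mono fun z hz => ?_).congr fun z hz => ?_
    · exact e2 z hz.1.2
    · simpa using h21 z (e2 z hz.1.2)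
  · simpa using (hself inftyChart).mono (by intro z hz; exact Set.mem_univ _)

end RiemannSphere

open RiemannSphere

/-! ### Riemann surfaces: ramification index, meromorphic functions -/

section Surface

variable {M : Type*} [TopologicalSpace M] [ChartedSpace ℂ M]

/-- The ramification index at `p` of a map `π` from a Riemann surface to the Riemann sphere: the
multiplicity with which `π`, read in charts, takes the value `π p` at `p`. -/
def ramificationIndex (π : M → OnePoint ℂ) (p : M) : ℕ∞ :=
  analyticOrderAt
    (fun u => chartAt ℂ (π p) (π ((chartAt ℂ p).symm u)) - chartAt ℂ (π p) (π p)) (chartAt ℂ p p)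

/-- The tuple `x` lists the points of the fibre `π⁻¹(z)`, each repeated according to its
ramification index. -/
def ListsFibre {r : ℕ} (π : M → OnePoint ℂ) (z : OnePoint ℂ) (x : Fin r → M) : Prop :=
  (∀ k, π (x k) = z) ∧
    ∀ p, π p = z → ((Nat.card {k // x k = p} : ℕ) : ℕ∞) = ramificationIndex π p

variable {F : Type*} [NormedAddCommGroup F] [NormedSpace ℂ F]

/-- A scalar or vector valued function on a Riemann surface is meromorphic. A meromorphic function
is represented by its values off its poles, and by the value `0` at its poles. -/
def IsMeromorphicOn (f : M → F) : Prop :=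
  ∀ p, MeromorphicNFAt (fun u => f ((chartAt ℂ p).symm u)) (chartAt ℂ p p)

/-- The order at `p` of a scalar or vector valued meromorphic function: positive at zeros, negative
at poles. For a vector valued function this is the minimum of the orders of the entries. -/
def orderAt (f : M → F) (p : M) : ℤ :=
  (meromorphicOrderAt (fun u => f ((chartAt ℂ p).symm u)) (chartAt ℂ p p)).untop₀

/-- The set of all zeros and poles. -/
def zerosPoles (f : M → F) : Set M := {p | orderAt f p ≠ 0}

end Surface

/-! ### Contours and Christoffel-Darboux kernels -/

/-- A contour with `n` pieces. The piece `i` consists of `m` oriented curves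
`curve i 0, …, curve i (m - 1)`, all parametrized by the same interval `dom i`. -/
structure Contour (n m : ℕ) where
  dom : Fin n → Set ℝ
  curve : Fin n → Fin m → ℝ → ℂ

/-- All curves of the contour are smooth regular curves, parametrized by intervals (bounded or
not). A finite union of piecewise smooth oriented curves is a contour with this property. -/
def Contour.IsSmooth {n m : ℕ} (Γ : Contour n m) : Prop :=
  ∀ i, (Γ.dom i).OrdConnected ∧ ∀ j, ContDiffOn ℝ 1 (Γ.curve i j) (Γ.dom i) ∧
    ∀ t ∈ Γ.dom i, derivWithin (Γ.curve i j) (Γ.dom i) t ≠ 0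

/-- The contour integral `∫_Γ g(w) dw` converges and has the value `v`. The contributions of curves
with the same parameter interval are added up before integrating over the parameter; if `g` is
integrable along every single curve, this is the sum of the integrals along the single curves. -/
def Contour.HasIntegral {n m : ℕ} (Γ : Contour n m) (g : ℂ → ℂ) (v : ℂ) : Prop :=
  (∀ i, MeasureTheory.IntegrableOn
    (fun t => ∑ j, g (Γ.curve i j t) * derivWithin (Γ.curve i j) (Γ.dom i) t) (Γ.dom i)) ∧
  ∑ i, ∫ t in Γ.dom i, ∑ j, g (Γ.curve i j t) * derivWithin (Γ.curve i j) (Γ.dom i) t = v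

/-- The value at `(w, z)` of a bivariate matrix polynomial. The outer polynomial variable stands
for the first argument `w`, the inner one for the second argument `z`. -/
def evalKernel {κ : Type*} (R : Matrix κ κ ℂ[X][X]) (w z : ℂ) : Matrix κ κ ℂ :=
  R.map fun q => ((q.eval (Polynomial.C w)).eval z)

/-- `R` is the Christoffel-Darboux kernel of size `N` for the matrix weight `W` on the contour `Γ`:
a matrix polynomial `R(w, z)` of degree at most `N - 1` in both `w` and `z` such that
`∫_Γ P(w) W(w) R(w, z) dw = P(z)` for all matrix polynomials `P` of degree at most `N - 1`, or such
that `∫_Γ R(w, z) W(z) P(z) dz = P(w)` for all of them. -/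
def IsCDKernel {n m : ℕ} {κ : Type*} [Fintype κ] (Γ : Contour n m) (W : ℂ → Matrix κ κ ℂ) (N : ℕ)
    (R : Matrix κ κ ℂ[X][X]) : Prop :=
  (∀ i j, R i j ∈ Polynomial.degreeLT ℂ[X] N ∧ ∀ k, (R i j).coeff k ∈ Polynomial.degreeLT ℂ N) ∧
  ((∀ P : Matrix κ κ ℂ[X], (∀ i j, P i j ∈ Polynomial.degreeLT ℂ N) → ∀ (z : ℂ) (i j : κ),
      Γ.HasIntegral (fun w => (P.map (Polynomial.eval w) * W w * evalKernel R w z) i j)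
        ((P i j).eval z)) ∨
   (∀ P : Matrix κ κ ℂ[X], (∀ i j, P i j ∈ Polynomial.degreeLT ℂ N) → ∀ (w : ℂ) (i j : κ),
      Γ.HasIntegral (fun z => (evalKernel R w z * W z * P.map (Polynomial.eval z)) i j)
        ((P i j).eval w)))

/-- The value at `z` of a matrix of rational functions. -/
def evalRat {r : ℕ} (W : Matrix (Fin r) (Fin r) (RatFunc ℂ)) (z : ℂ) : Matrix (Fin r) (Fin r) ℂ :=
  W.map (RatFunc.eval (RingHom.id ℂ) z)

/-- No entry of `W` has a pole on the contour. -/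
def NoPoleOn {r n m : ℕ} (W : Matrix (Fin r) (Fin r) (RatFunc ℂ)) (Γ : Contour n m) : Prop :=
  ∀ a b i j, ∀ t ∈ Γ.dom i, (W a b).denom.eval (Γ.curve i j t) ≠ 0

/-! ### The `r`-sheeted Riemann surface of a diagonalizable weight -/

section Spectral

variable {M : Type*} [TopologicalSpace M] [ChartedSpace ℂ M] {r : ℕ}

/-- `π : M → ℂ ∪ {∞}` is an `r`-sheeted branched covering, `sheet k z` is the point on the `k`-th
sheet over `z`, and `lam`, `e`, `einv` are meromorphic functions on `M` such that, for all but
finitely many `z`, one has `W(z) = E(z) diag(Lam(z)) E(z)⁻¹`, and on the `k`-th sheet over `z` the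
function `lam` is the `k`-th eigenvalue, `e` the `k`-th column of `E(z)` and `einv` the `k`-th row
of `E(z)⁻¹`. -/
structure IsSpectralSurface (W : Matrix (Fin r) (Fin r) (RatFunc ℂ))
    (E : ℂ → Matrix (Fin r) (Fin r) ℂ) (Lam : ℂ → Fin r → ℂ)
    (π : M → OnePoint ℂ) (sheet : Fin r → OnePoint ℂ → M)
    (lam : M → ℂ) (e einv : M → Fin r → ℂ) : Prop where
  holomorphic : ContMDiff 𝓘(ℂ) 𝓘(ℂ) ⊤ π
  sheets : ∀ z, ListsFibre π z fun k => sheet k z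
  diagonalization : ∀ᶠ z in Filter.cofinite,
    IsUnit (E z) ∧ evalRat W z = E z * Matrix.diagonal (Lam z) * (E z)⁻¹
  meromorphic_lam : IsMeromorphicOn lam
  meromorphic_e : IsMeromorphicOn e
  meromorphic_einv : IsMeromorphicOn einv
  lam_sheet : ∀ᶠ z : ℂ in Filter.cofinite, ∀ k, lam (sheet k z) = Lam z k
  e_sheet : ∀ᶠ z : ℂ in Filter.cofinite, ∀ k i, e (sheet k z) i = E z i k
  einv_sheet : ∀ᶠ z : ℂ in Filter.cofinite, ∀ k i, einv (sheet k z) i = (E z)⁻¹ k i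

/-- `lift` parametrizes the contour on `M` that consists of the `r` copies of `γ`, one on each
sheet: `lift i 0, …, lift i (r - 1)` are continuous curves on `M` which, at each time `t`, list the
fibre over the point `γ(t)` of the `i`-th piece of `γ`. -/
def IsLiftedContour {n : ℕ} (π : M → OnePoint ℂ) (γ : Contour n 1) (lift : Fin n → Fin r → ℝ → M) :
    Prop :=
  ∀ i, (∀ j, ContinuousOn (lift i j) (γ.dom i)) ∧
    ∀ t ∈ γ.dom i, ListsFibre π (γ.curve i 0 t : ℂ) fun j => lift i j t

/-- The space `L_N = {z ↦ P(z) v(z)}` of meromorphic functions on `M`, where `P` runs through the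
vectors of `r` polynomials of degree at most `N - 1` in the projection of the point of `M`, and
`v = e`. The choice `v = einv` gives `L_N^* = {z ↦ einv(z) P(z)}`. The values of the representatives
at the finitely many poles and points at infinity are immaterial. -/
def meroSpace (π : M → OnePoint ℂ) (v : M → Fin r → ℂ) (N : ℕ) : Submodule ℂ (M → ℂ) where
  carrier := {f | ∃ P : Fin r → ℂ[X], (∀ i, P i ∈ Polynomial.degreeLT ℂ N) ∧
    f = fun p => ∑ i, (P i).eval (coord (π p)) * v p i}
  zero_mem' := ⟨0, fun _ => Submodule.zero_mem _, by ext p; simp⟩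
  add_mem' := by
    rintro _ _ ⟨P, hP, rfl⟩ ⟨Q, hQ, rfl⟩
    refine ⟨P + Q, fun i => Submodule.add_mem _ (hP i) (hQ i), ?_⟩
    ext p
    simp [add_mul, Finset.sum_add_distrib]
  smul_mem' := by
    rintro c _ ⟨P, hP, rfl⟩
    refine ⟨c • P, fun i => Submodule.smul_mem _ c (hP i), ?_⟩
    ext p
    simp [Finset.mul_sum, mul_assoc]

end Spectral

/-! ### Genus zero: the objects in the plane

A connected compact Riemann surface of genus zero is given together with a biholomorphic map `φ`
from the Riemann sphere onto it. -/

section GenusZero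

variable {M : Type*} [TopologicalSpace M] [ChartedSpace ℂ M] {r : ℕ}

/-- The projection to the plane of the point `φ(ζ)`. -/
def planeProj (φ : Diffeomorph 𝓘(ℂ) 𝓘(ℂ) (OnePoint ℂ) M ⊤) (π : M → OnePoint ℂ) (ζ : ℂ) : ℂ :=
  coord (π (φ ζ))

/-- The rational function
`∏_{j : ∞⁽ʲ⁾ ≠ φ(∞)} (ζ - φ⁻¹(∞⁽ʲ⁾))^(N-1) * ∏_{p} (ζ - φ⁻¹(p))^(-n_p)`, where `p` runs through the
zeros and poles of `v` different from `φ(∞)` and `n_p` is the order of `v` at `p`. It is `h` for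
`v = e`, and `ĥ` for `v = einv`. -/
def clearing (φ : Diffeomorph 𝓘(ℂ) 𝓘(ℂ) (OnePoint ℂ) M ⊤) (sheet : Fin r → OnePoint ℂ → M)
    (v : M → Fin r → ℂ) (N : ℕ) (ζ : ℂ) : ℂ :=
  open Classical in
  (∏ j ∈ Finset.univ.filter fun j : Fin r => sheet j ∞ ≠ φ ∞,
      (ζ - coord (φ.symm (sheet j ∞))) ^ (N - 1)) *
    ∏ᶠ p ∈ zerosPoles v \ {φ ∞}, (ζ - coord (φ.symm p)) ^ (-orderAt v p)

/-- The points `ζ` of the plane such that `φ(ζ)` is neither a point at infinity of `M` nor a zero or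
pole of `v`; these are all points of the plane up to finitely many. -/
def regularPoints (φ : Diffeomorph 𝓘(ℂ) 𝓘(ℂ) (OnePoint ℂ) M ⊤) (π : M → OnePoint ℂ)
    (v : M → Fin r → ℂ) : Set ℂ :=
  {ζ | π (φ ζ) ≠ ∞ ∧ φ ζ ∉ zerosPoles v}

/-- The polynomial space of all `p(ζ) = f(φ(ζ)) h(ζ)` with `f ∈ L_N`. It is `V` for `v = e`, and
`V^*` for `v = einv`. The identity of rational functions is stated off their finitely many possible
singularities. -/
def polySpace (φ : Diffeomorph 𝓘(ℂ) 𝓘(ℂ) (OnePoint ℂ) M ⊤) (π : M → OnePoint ℂ)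
    (sheet : Fin r → OnePoint ℂ → M) (v : M → Fin r → ℂ) (N : ℕ) : Submodule ℂ ℂ[X] where
  carrier := {p | ∃ f ∈ meroSpace π v N, ∀ ζ ∈ regularPoints φ π v,
    p.eval ζ = f (φ ζ) * clearing φ sheet v N ζ}
  zero_mem' := ⟨0, Submodule.zero_mem _, by simp⟩
  add_mem' := by
    rintro p q ⟨f, hf, hp⟩ ⟨g, hg, hq⟩
    refine ⟨f + g, Submodule.add_mem _ hf hg, fun ζ hζ => ?_⟩
    rw [Polynomial.eval_add, hp ζ hζ, hq ζ hζ, Pi.add_apply, add_mul]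
  smul_mem' := by
    rintro c p ⟨f, hf, hp⟩
    refine ⟨c • f, Submodule.smul_mem _ c hf, fun ζ hζ => ?_⟩
    rw [Polynomial.eval_smul, hp ζ hζ, Pi.smul_apply, smul_eq_mul, smul_eq_mul, mul_assoc]

/-- The bivariate polynomial `K` is the scalar kernel
`ĥ(u) einv(φ(u)) R(ϕ(u), ϕ(ζ)) e(φ(ζ)) h(ζ)`, where `ϕ(u)` is the projection of `φ(u)` to the
plane. The identity of rational functions is stated off their finitely many possible singularities
in each variable. -/
def IsScalarKernel (φ : Diffeomorph 𝓘(ℂ) 𝓘(ℂ) (OnePoint ℂ) M ⊤) (π : M → OnePoint ℂ)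
    (sheet : Fin r → OnePoint ℂ → M) (e einv : M → Fin r → ℂ) (N : ℕ)
    (R : Matrix (Fin r) (Fin r) ℂ[X][X]) (K : ℂ[X][X]) : Prop :=
  ∀ u ∈ regularPoints φ π einv, ∀ ζ ∈ regularPoints φ π e,
    (K.eval (Polynomial.C u)).eval ζ =
      clearing φ sheet einv N u *
        dotProduct (einv (φ u))
          ((evalKernel R (planeProj φ π u) (planeProj φ π ζ)).mulVec (e (φ ζ))) *
        clearing φ sheet e N ζ

/-- The scalar weight `𝒲(u) = lam(φ(u)) ϕ'(u) / (h(u) ĥ(u))`. -/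
def scalarWeight (φ : Diffeomorph 𝓘(ℂ) 𝓘(ℂ) (OnePoint ℂ) M ⊤) (π : M → OnePoint ℂ)
    (sheet : Fin r → OnePoint ℂ → M) (lam : M → ℂ) (e einv : M → Fin r → ℂ) (N : ℕ) (u : ℂ) : ℂ :=
  lam (φ u) / (clearing φ sheet e N u * clearing φ sheet einv N u) * deriv (planeProj φ π) u

/-- The preimage under `φ` of the contour on `M` parametrized by `lift`. -/
def planeContour {n : ℕ} (φ : Diffeomorph 𝓘(ℂ) 𝓘(ℂ) (OnePoint ℂ) M ⊤) (γ : Contour n 1)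
    (lift : Fin n → Fin r → ℝ → M) : Contour n r where
  dom := γ.dom
  curve := fun i j t => coord (φ.symm (lift i j t))

end GenusZero

end

/-! Read through `φ`, everything becomes polynomial. The projection `ϕ = π ∘ φ` is a fraction `A /
B` whose larger degree is `r`, and clearing zeros and poles turns `e` and `einv` into polynomial
vectors `ε` and `ε'` without common zeros, whose largest degrees are minus the total orders. On
regular points `h` is `B ^ (N - 1)` times the clearing product, so `V` is spanned by the polynomials
`ε i * A ^ a * B ^ (N - 1 - a)` with `a < N`, and `V^*` likewise with `ε'`. They are independent: by
`E⁻¹ E = 1` the vectors `ε'` and `ε` are dual, up to nonzero factors, along a generic fibre, so the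
`r` values of `ε` there form an invertible matrix.

For (a)-(d), the reproducing property of `R` says that its coefficient matrix is inverse to the
block matrix of moments `∫ w ^ (a + c) W i j dw` (`IsCDKernel.moments`). Either one-sided formula
suffices, since one-sided inverses of square matrices are two-sided. The scalar kernel has the same
coefficient matrix with respect to the bases of `V^*` and `V`. The moments of the scalar weight in
these bases are also unchanged (`hasIntegral_scalarWeight`): the clearing factors cancel, `ϕ' du =
dz` along the lifts, and the sum of `e i * lam * einv j` over the sheets is `W i j`. Matrix and
inverse then cancel.

For (e), `V` consists of all polynomials of degree less than `r * N` exactly when every `ε i` has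
degree less than `r`; as the `r` polynomials `ε i` are independent, their largest degree is then `r
- 1`. The decisive point is that this bound passes from `ε` to `ε'` (`natDegree_lt_of_dual`). A
combination of the `ε i` vanishing on a fibre except at one point `x k` becomes, after
multiplication by `X - x k`, a multiple of `A - z * B`. Comparison with a second fibre determines
the dual combinations up to a common factor, which is constant because `ε'` has no common zero. -/

/-! ### Dual systems of polynomials along the fibres of a rational function -/

section DualFibre

open Polynomial

/-- `x` lists the points of the fibre over `z` of the rational function `A / B`, and along this
fibre the vectors `ε` and `ε'` are dual to each other up to nonzero factors. -/
structure IsDualFibre {r : ℕ} (A B : ℂ[X]) (ε ε' : Fin r → ℂ[X]) (z : ℂ) (x : Fin r → ℂ) :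
    Prop where
  injective : Function.Injective x
  denom_ne_zero : ∀ k, B.eval (x k) ≠ 0
  eval_eq : ∀ k, A.eval (x k) = z * B.eval (x k)
  off_diag : ∀ k l, k ≠ l → ∑ i, (ε' i).eval (x k) * (ε i).eval (x l) = 0
  diag : ∀ k, ∑ i, (ε' i).eval (x k) * (ε i).eval (x k) ≠ 0

variable {r : ℕ} {A B : ℂ[X]} {ε ε' : Fin r → ℂ[X]} {z : ℂ} {x : Fin r → ℂ}

theorem IsDualFibre.symm (h : IsDualFibre A B ε ε' z x) : IsDualFibre A B ε' ε z x where
  injective := h.injective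
  denom_ne_zero := h.denom_ne_zero
  eval_eq := h.eval_eq
  off_diag k l hkl := by
    simpa [mul_comm] using h.off_diag l k hkl.symm
  diag k := by simpa [mul_comm] using h.diag k

theorem IsDualFibre.det_ne_zero (h : IsDualFibre A B ε ε' z x) :
    (Matrix.of fun i l => (ε i).eval (x l)).det ≠ 0 := by
  have hmul : (Matrix.of fun k i => (ε' i).eval (x k)) * (Matrix.of fun i l => (ε i).eval (x l)) =
      Matrix.diagonal fun k => ∑ i, (ε' i).eval (x k) * (ε i).eval (x k) := by
    ext k l
    by_cases hkl : k = l
    · subst hkl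
      simp [Matrix.mul_apply]
    · simp [Matrix.mul_apply, hkl, h.off_diag k l hkl]
  intro h0
  have := congrArg Matrix.det hmul
  rw [Matrix.det_mul, h0, mul_zero, Matrix.det_diagonal] at this
  exact Finset.prod_ne_zero_iff.2 (fun k _ => h.diag k) this.symm

theorem IsDualFibre.eq_zero (h : IsDualFibre A B ε ε' z x) {c : Fin r → ℂ}
    (hc : ∀ l, ∑ i, c i * (ε i).eval (x l) = 0) : c = 0 :=
  Matrix.eq_zero_of_vecMul_eq_zero h.det_ne_zero <| by
    ext l
    simpa [Matrix.vecMul, dotProduct] using hc l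

/-- The polynomials `ε i * A ^ a * B ^ (N - 1 - a)`, for `a < N`. -/
noncomputable def homogenized (A B : ℂ[X]) (ε : Fin r → ℂ[X]) (N : ℕ) (q : Fin r × Fin N) : ℂ[X] :=
  ε q.1 * (A ^ (q.2 : ℕ) * B ^ (N - 1 - (q.2 : ℕ)))

theorem eval_homogenized {w : ℂ} {N : ℕ} (hw : A.eval w = z * B.eval w) (q : Fin r × Fin N) :
    (homogenized A B ε N q).eval w = z ^ (q.2 : ℕ) * (ε q.1).eval w * B.eval w ^ (N - 1) := by
  have h : B.eval w ^ (N - 1) = B.eval w ^ (q.2 : ℕ) * B.eval w ^ (N - 1 - (q.2 : ℕ)) := by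
    rw [← pow_add]
    congr 1
    omega
  simp only [homogenized, eval_mul, eval_pow, hw, h, mul_pow]
  ring

/-- A relation groups into coefficient polynomials `p i`. On the fibre over `z` the common factor `B
^ (N - 1)` drops out and the vector `p i (z)` is annihilated by an invertible matrix, so each `p i`
has infinitely many roots. -/
theorem linearIndependent_homogenized (N : ℕ)
    (h : Set.Infinite {z | ∃ x, IsDualFibre A B ε ε' z x}) :
    LinearIndependent ℂ (homogenized A B ε N) := by
  rw [Fintype.linearIndependent_iff]
  intro g hg
  let p : Fin r → ℂ[X] := fun i => ∑ a : Fin N, monomial (a : ℕ) (g (i, a))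
  have hp : ∀ i, p i = 0 := by
    intro i
    refine eq_zero_of_infinite_isRoot _ (h.mono ?_)
    rintro z ⟨x, hx⟩
    have : (fun i => (p i).eval z) = 0 := by
      refine hx.eq_zero fun l => ?_
      have h1 := congrArg (eval (x l)) hg
      simp only [eval_finsetSum, eval_smul, eval_homogenized (hx.eval_eq l), smul_eq_mul, eval_zero,
        Fintype.sum_prod_type] at h1
      have h2 : (∑ i, (p i).eval z * (ε i).eval (x l)) * B.eval (x l) ^ (N - 1) = 0 := by
        rw [← h1, Finset.sum_mul]
        refine Finset.sum_congr rfl fun i _ => ?_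
        simp only [p, eval_finsetSum, eval_monomial, Finset.sum_mul]
        exact Finset.sum_congr rfl fun a _ => by ring
      exact (mul_eq_zero.1 h2).resolve_right (pow_ne_zero _ (hx.denom_ne_zero l))
    exact congrFun this i
  rintro ⟨i, a⟩
  have h3 := congrArg (fun q => coeff q (a : ℕ)) (hp i)
  simpa [p, finsetSum_coeff, coeff_monomial, Fin.val_inj] using h3

theorem dvd_of_forall_eval_eq_zero {ι : Type*} [Fintype ι] {x : ι → ℂ} (hx : Function.Injective x)
    {p : ℂ[X]} (hp : ∀ i, p.eval (x i) = 0) : ∏ i, (X - C (x i)) ∣ p := by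
  refine Finset.prod_dvd_of_coprime ?_ fun i _ => dvd_iff_isRoot.2 (hp i)
  exact fun i _ j _ hij => isCoprime_X_sub_C_of_isUnit_sub (sub_ne_zero.2 (hx.ne hij)).isUnit

theorem exists_eq_C_mul_prod {x : Fin r → ℂ} (hx : Function.Injective x)
    {p : ℂ[X]} (hp : ∀ i, p.eval (x i) = 0) (hd : p.natDegree ≤ r) :
    ∃ c : ℂ, p = C c * ∏ i, (X - C (x i)) := by
  obtain ⟨q, hq⟩ := dvd_of_forall_eval_eq_zero hx hp
  have hm : (∏ i, (X - C (x i))).Monic := monic_prod_of_monic _ _ fun i _ => monic_X_sub_C _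
  have hdeg : (∏ i, (X - C (x i))).natDegree = r := by
    rw [natDegree_prod_of_monic _ _ fun i _ => monic_X_sub_C _]
    simp
  by_cases hq0 : q = 0
  · exact ⟨0, by rw [hq, hq0]; simp⟩
  · have h1 : p.natDegree = r + q.natDegree := by
      rw [hq, hm.natDegree_mul' hq0, hdeg]
    obtain ⟨c, hc⟩ := natDegree_eq_zero.1 (show q.natDegree = 0 by omega)
    exact ⟨c, by rw [hq, ← hc, mul_comm]⟩

/-- Write `F = ∑ i, ε' i (x k) * ε i`. Both `(X - x k) * F` and `A - z * B` have degree at most `r`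
and vanish at all `x i`, so both are constants times `∏ (X - x i)`. At a point `y l` over `z₀` the
second one equals `(z₀ - z) * B (y l)`; eliminating the product between `y l` and `y m` leaves the
identity. -/
theorem IsDualFibre.cross_eq (hε : ∀ i, (ε i).natDegree < r) (hA : A.natDegree ≤ r)
    (hB : B.natDegree ≤ r) {z₀ : ℂ} {y : Fin r → ℂ} (hy : IsDualFibre A B ε ε' z₀ y)
    (hx : IsDualFibre A B ε ε' z x) (hz : z ≠ z₀) (k l m : Fin r) :
    B.eval (y m) * (y l - x k) * (∑ i, (ε i).eval (y l) * (ε' i).eval (x k)) =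
      B.eval (y l) * (y m - x k) * (∑ i, (ε i).eval (y m) * (ε' i).eval (x k)) := by
  obtain ⟨c, hc⟩ := exists_eq_C_mul_prod hx.injective
    (p := (X - C (x k)) * ∑ i, C ((ε' i).eval (x k)) * ε i) (fun j => by
      by_cases hj : k = j
      · simp [hj]
      · simp [eval_finsetSum, hx.off_diag k j hj]) (by
      refine natDegree_mul_le.trans ?_
      have h0 : (∑ i, C ((ε' i).eval (x k)) * ε i).natDegree ≤ r - 1 :=
        natDegree_sum_le_of_forall_le _ _ fun i _ =>
          (natDegree_C_mul_le _ _).trans (Nat.le_sub_one_of_lt (hε i))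
      have h1 : 0 < r := k.pos
      rw [natDegree_X_sub_C]
      omega)
  obtain ⟨d, hd⟩ := exists_eq_C_mul_prod hx.injective
    (p := A - C z * B) (fun j => by simp [hx.eval_eq j]) (by
      refine (natDegree_sub_le _ _).trans (max_le hA ((natDegree_C_mul_le _ _).trans hB)))
  have h1 : ∀ l, (y l - x k) * (∑ i, (ε i).eval (y l) * (ε' i).eval (x k)) =
      c * (∏ i, (X - C (x i))).eval (y l) := fun l => by
    have := congrArg (eval (y l)) hc
    simpa [eval_finsetSum, mul_comm] using this
  have h2 : ∀ l, (z₀ - z) * B.eval (y l) = d * (∏ i, (X - C (x i))).eval (y l) := fun l => by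
    have := congrArg (eval (y l)) hd
    rw [eval_mul, eval_C, eval_sub, eval_mul, eval_C, hy.eval_eq] at this
    rw [← this]
    ring
  have h3 : z₀ - z ≠ 0 := sub_ne_zero.2 hz.symm
  apply mul_left_cancel₀ h3
  calc _ = ((z₀ - z) * B.eval (y m)) *
        ((y l - x k) * (∑ i, (ε i).eval (y l) * (ε' i).eval (x k))) := by ring
    _ = ((z₀ - z) * B.eval (y l)) *
        ((y m - x k) * (∑ i, (ε i).eval (y m) * (ε' i).eval (x k))) := by
      rw [h1, h1, h2, h2]; ring
    _ = _ := by ring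

/-- If the polynomials `ε i` have degree less than `r`, so have the dual ones. -/
theorem natDegree_lt_of_dual (hε : ∀ i, (ε i).natDegree < r) (hA : A.natDegree ≤ r)
    (hB : B.natDegree ≤ r) (h : Set.Infinite {z | ∃ x, IsDualFibre A B ε ε' z x})
    (hε' : ∀ w, ∃ i, (ε' i).eval w ≠ 0) (i : Fin r) : (ε' i).natDegree < r := by
  obtain ⟨z₀, y, hy⟩ := h.nonempty
  let q : Fin r → ℂ[X] := fun l => ∑ i, C ((ε i).eval (y l)) * ε' i
  -- `cross_eq` gives this at every point of every fibre other than the one over `z₀`, hence at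
  -- infinitely many points.
  have hq : ∀ l m, C (B.eval (y m)) * (X - C (y l)) * q l =
      C (B.eval (y l)) * (X - C (y m)) * q m := by
    intro l m
    have hinf : Set.Infinite {w | ∃ z ≠ z₀, ∃ x, IsDualFibre A B ε ε' z x ∧ x i = w} := by
      have h1 : Set.Infinite ({z | ∃ x, IsDualFibre A B ε ε' z x} \ {z₀}) :=
        h.sdiff (Set.finite_singleton _)
      refine Set.Infinite.of_image (fun w => A.eval w / B.eval w) (h1.mono ?_)
      rintro z ⟨⟨x, hx⟩, hz⟩
      refine ⟨x i, ⟨z, hz, x, hx, rfl⟩, ?_⟩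
      simp only
      rw [hx.eval_eq, mul_div_cancel_right₀ _ (hx.denom_ne_zero i)]
    refine eq_of_infinite_eval_eq _ _ (hinf.mono ?_)
    rintro _ ⟨z, hz, x, hx, rfl⟩
    have := hy.cross_eq hε hA hB hx hz i l m
    simp only [q, Set.mem_ofPred_eq, eval_mul, eval_C, eval_sub, eval_X, eval_finsetSum]
    linear_combination -this
  -- By `hq`, the polynomial `(X - y i) * q i / B (y i)` does not depend on `i`, so it vanishes at
  -- every `y l`.
  obtain ⟨G, hG⟩ := dvd_of_forall_eval_eq_zero hy.injective
    (p := C (B.eval (y i))⁻¹ * (X - C (y i)) * q i) (fun l => by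
      have h1 := congrArg (eval (y l)) (hq l i)
      simp only [eval_mul, eval_C, eval_sub, eval_X, sub_self, mul_zero, zero_mul] at h1
      have h2 : (y l - y i) * (q i).eval (y l) = 0 := by
        have := hy.denom_ne_zero l
        apply mul_left_cancel₀ this
        rw [mul_zero, ← mul_assoc]
        exact h1.symm
      simp only [eval_mul, eval_C, eval_sub, eval_X]
      rw [mul_assoc, h2, mul_zero])
  have hqG : ∀ l, q l = C (B.eval (y l)) * G * ∏ m ∈ Finset.univ.erase l, (X - C (y m)) := by
    intro l
    apply mul_left_cancel₀ (X_sub_C_ne_zero (y l))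
    apply mul_left_cancel₀ (C_ne_zero.2 (hy.denom_ne_zero i))
    rw [← mul_assoc, hq l i]
    have h1 : (X - C (y l)) * ∏ m ∈ Finset.univ.erase l, (X - C (y m)) = ∏ m, (X - C (y m)) :=
      Finset.mul_prod_erase _ (fun m => X - C (y m)) (Finset.mem_univ l)
    have h2 : C (B.eval (y i)) * C (B.eval (y i))⁻¹ = 1 := by
      rw [← C_mul, mul_inv_cancel₀ (hy.denom_ne_zero i), C_1]
    calc _ = C (B.eval (y l)) * (C (B.eval (y i)) * (C (B.eval (y i))⁻¹ * (X - C (y i)) * q i)) := by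
          linear_combination (-C (B.eval (y l)) * (X - C (y i)) * q i) * h2
      _ = C (B.eval (y l)) * (C (B.eval (y i)) * (((X - C (y l)) *
            ∏ m ∈ Finset.univ.erase l, (X - C (y m))) * G)) := by rw [hG, h1]
      _ = _ := by ring
  -- the `ε'` are combinations of the `q`
  let Q : Matrix (Fin r) (Fin r) ℂ := Matrix.of fun i l => (ε i).eval (y l)
  have hdet : IsUnit Q.det := hy.det_ne_zero.isUnit
  have hε'q : ∀ j, ε' j = ∑ l, C (Q⁻¹ l j) * q l := by
    intro j
    have h1 : ∀ i, ∑ l, Q i l * Q⁻¹ l j = if i = j then 1 else 0 := fun i => by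
      rw [← Matrix.mul_apply, Matrix.mul_nonsing_inv _ hdet, Matrix.one_apply]
    calc ε' j = ∑ i, C (∑ l, Q i l * Q⁻¹ l j) * ε' i := by simp [h1, apply_ite C, ite_mul]
      _ = ∑ l, C (Q⁻¹ l j) * q l := by
        simp only [q, map_sum, Finset.sum_mul, Finset.mul_sum]
        rw [Finset.sum_comm]
        refine Finset.sum_congr rfl fun l _ => Finset.sum_congr rfl fun i _ => ?_
        simp only [Q, Matrix.of_apply, C_mul]
        ring
  -- A root of `G` would be a common zero of all `q l`, hence of all `ε' j`.
  have hGu : G.natDegree = 0 := by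
    by_contra hne
    have h0 : G.degree ≠ 0 := fun h => hne (natDegree_eq_of_degree_eq_some h)
    obtain ⟨w, hw⟩ := IsAlgClosed.exists_root G h0
    obtain ⟨j, hj⟩ := hε' w
    refine hj ?_
    rw [hε'q j, eval_finsetSum]
    refine Finset.sum_eq_zero fun l _ => ?_
    rw [hqG l]
    simp [hw.eq_zero]
  rw [hε'q i]
  have hr : 0 < r := i.pos
  refine Nat.lt_of_le_sub_one hr (natDegree_sum_le_of_forall_le _ _ fun l _ =>
    (natDegree_C_mul_le _ _).trans ?_)
  rw [hqG l]
  refine natDegree_mul_le.trans ?_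
  have h1 : (∏ m ∈ Finset.univ.erase l, (X - C (y m))).natDegree ≤ r - 1 := by
    rw [natDegree_prod_of_monic _ _ fun i _ => monic_X_sub_C _]
    simp
  have h2 : (C (B.eval (y l)) * G).natDegree ≤ 0 := (natDegree_C_mul_le _ _).trans hGu.le
  omega

end DualFibre

/-! ### Degree criteria for the polynomial spaces -/

section Degrees

open Polynomial

variable {r : ℕ} {A B : ℂ[X]} {ε ε' : Fin r → ℂ[X]}

theorem finrank_degreeLT (n : ℕ) : Module.finrank ℂ (degreeLT ℂ n) = n := by
  rw [LinearEquiv.finrank_eq (degreeLTEquiv ℂ n)]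
  simp

theorem mem_degreeLT_iff_natDegree_lt {p : ℂ[X]} {n : ℕ} (hn : 0 < n) :
    p ∈ degreeLT ℂ n ↔ p.natDegree < n := by
  by_cases hp : p = 0
  · simp [hp, hn]
  · rw [mem_degreeLT, natDegree_lt_iff_degree_lt hp]

theorem span_eq_degreeLT_iff {ι : Type*} [Fintype ι] {b : ι → ℂ[X]} (hb : LinearIndependent ℂ b) :
    Submodule.span ℂ (Set.range b) = degreeLT ℂ (Fintype.card ι) ↔
      ∀ i, b i ∈ degreeLT ℂ (Fintype.card ι) := by
  refine ⟨fun h i => h ▸ Submodule.subset_span ⟨i, rfl⟩, fun h => ?_⟩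
  have : FiniteDimensional ℂ (degreeLT ℂ (Fintype.card ι)) :=
    (degreeLTEquiv ℂ (Fintype.card ι)).symm.finiteDimensional
  refine Submodule.eq_of_le_of_finrank_eq (Submodule.span_le.2 ?_) ?_
  · rintro _ ⟨i, rfl⟩
    exact h i
  · rw [finrank_span_eq_card hb, finrank_degreeLT]

/-- The extreme elements `ε i * A ^ (N - 1)` and `ε i * B ^ (N - 1)` decide: for whichever of `A`,
`B` has degree `r`, the degree is that of `ε i` plus `r * (N - 1)`. -/
theorem forall_homogenized_natDegree_lt_iff {N : ℕ} (hN : 0 < N) (hA : A.natDegree ≤ r)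
    (hB : B.natDegree ≤ r) (hAB : A.natDegree = r ∨ B.natDegree = r) :
    (∀ q, (homogenized A B ε N q).natDegree < r * N) ↔ ∀ i, (ε i).natDegree < r := by
  obtain ⟨m, rfl⟩ : ∃ m, N = m + 1 := ⟨N - 1, by omega⟩
  constructor
  · intro h i
    by_contra! hi
    have hr : 0 < r := i.pos
    have hε : ε i ≠ 0 := by
      rintro h0
      simp [h0] at hi
      omega
    rcases hAB with hr' | hr'
    · have h0 : A ≠ 0 := by
        rintro rfl
        simp at hr'
        omega
      have := h (i, ⟨m, by omega⟩)
      simp only [homogenized, Nat.add_sub_cancel, Nat.sub_self, pow_zero, mul_one] at this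
      rw [natDegree_mul hε (pow_ne_zero _ h0), natDegree_pow, hr'] at this
      nlinarith
    · have h0 : B ≠ 0 := by
        rintro rfl
        simp at hr'
        omega
      have := h (i, ⟨0, by omega⟩)
      simp only [homogenized, Nat.add_sub_cancel, Nat.sub_zero, pow_zero, one_mul] at this
      rw [natDegree_mul hε (pow_ne_zero _ h0), natDegree_pow, hr'] at this
      nlinarith
  · rintro h ⟨i, a, ha⟩
    refine natDegree_mul_le.trans_lt ?_
    have h1 : (A ^ a * B ^ (m + 1 - 1 - a)).natDegree ≤ a * r + (m - a) * r :=
      natDegree_mul_le.trans (add_le_add (natDegree_pow_le_of_le _ hA)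
        (natDegree_pow_le_of_le _ hB))
    rw [← add_mul, show a + (m - a) = m by omega] at h1
    have h2 := h i
    simp only [] at h1 ⊢
    nlinarith

/-- The `r` polynomials `ε i` are independent, so their largest degree cannot be below `r - 1`. -/
theorem degree_eq_iff_forall_lt (h : Set.Infinite {z | ∃ x, IsDualFibre A B ε ε' z x})
    {D : ℤ} (hle : ∀ i, ((ε i).natDegree : ℤ) ≤ D) (hD : ∃ i, ((ε i).natDegree : ℤ) = D) :
    D = r - 1 ↔ ∀ i, (ε i).natDegree < r := by
  constructor
  · intro hDr i
    have := hle i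
    omega
  · intro hlt
    obtain ⟨j, hj⟩ := hD
    -- For `N = 1` the homogenized family is `ε` itself.
    have hε : LinearIndependent ℂ ε := by
      have := (linearIndependent_homogenized 1 h).comp (fun i => (i, (0 : Fin 1)))
        (fun i j hij => by simpa using hij)
      convert this using 1
      ext1 i
      simp [homogenized]
    have h1 : Submodule.span ℂ (Set.range ε) ≤ degreeLT ℂ ((ε j).natDegree + 1) := by
      rw [Submodule.span_le]
      rintro _ ⟨i, rfl⟩
      rw [SetLike.mem_coe, mem_degreeLT_iff_natDegree_lt (Nat.succ_pos _)]
      have := hle i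
      omega
    have : FiniteDimensional ℂ (degreeLT ℂ ((ε j).natDegree + 1)) :=
      (degreeLTEquiv ℂ _).symm.finiteDimensional
    have h2 := Submodule.finrank_mono h1
    rw [finrank_span_eq_card hε, finrank_degreeLT, Fintype.card_fin] at h2
    have h3 := hlt j
    omega

end Degrees

/-! ### Meromorphic vectors on the sphere and polynomials -/

section Entire

open Polynomial Filter Asymptotics

/-- Extended Liouville theorem by induction: the difference quotient at `0` is again entire and
grows with one power less. -/
theorem Differentiable.exists_polynomial_of_isBigO {d : ℕ} {f : ℂ → ℂ} (hf : Differentiable ℂ f)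
    (hO : f =O[cocompact ℂ] fun z => z ^ d) : ∃ p : ℂ[X], ∀ z, f z = p.eval z := by
  induction d generalizing f with
  | zero =>
    obtain ⟨c, hc⟩ := hO.bound
    simp only [pow_zero, norm_one, mul_one] at hc
    have hb : Bornology.IsBounded (Set.range f) := by
      obtain ⟨K, hK, hKc⟩ := Filter.mem_cocompact.1 hc
      refine ((hK.image hf.continuous).isBounded.union
        (Metric.isBounded_closedBall (x := (0 : ℂ)) (r := c))).subset ?_
      rintro _ ⟨z, rfl⟩
      by_cases hz : z ∈ K
      · exact Or.inl ⟨z, hz, rfl⟩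
      · exact Or.inr (by simpa using hKc hz)
    obtain ⟨a, ha⟩ := hf.exists_const_forall_eq_of_bounded hb
    exact ⟨C a, fun z => by simp [ha]⟩
  | succ d ih =>
    have hg : Differentiable ℂ (dslope f 0) := by
      rw [← differentiableOn_univ]
      exact (Complex.differentiableOn_dslope univ_mem).2 hf.differentiableOn
    have h0 : ∀ᶠ z : ℂ in cocompact ℂ, z ≠ 0 := isCompact_singleton.compl_mem_cocompact
    have hconst : (fun _ : ℂ => f 0) =O[cocompact ℂ] fun z => z ^ (d + 1) := by
      refine IsBigO.of_bound ‖f 0‖ ?_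
      have h1 : ∀ᶠ z : ℂ in cocompact ℂ, 1 ≤ ‖z‖ :=
        (tendsto_norm_cocompact_atTop).eventually_ge_atTop 1
      filter_upwards [h1] with z hz
      rw [norm_pow]
      exact le_mul_of_one_le_right (norm_nonneg _) (one_le_pow₀ hz)
    have hgO : dslope f 0 =O[cocompact ℂ] fun z => z ^ d := by
      have h1 := (isBigO_refl (fun z : ℂ => z⁻¹) (cocompact ℂ)).mul (hO.sub hconst)
      refine (h1.congr' ?_ ?_)
      · filter_upwards [h0] with z hz
        rw [dslope_of_ne _ hz, slope_def_field, sub_zero, div_eq_inv_mul]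
      · filter_upwards [h0] with z hz
        rw [pow_succ', inv_mul_cancel_left₀ hz]
    obtain ⟨p, hp⟩ := ih hg hgO
    refine ⟨C (f 0) + X * p, fun z => ?_⟩
    have := sub_smul_dslope f 0 z
    simp only [sub_zero, smul_eq_mul] at this
    simp only [eval_add, eval_C, eval_mul, eval_X, ← hp, this]
    ring

variable {ι : Type*} [Fintype ι]

theorem analyticAt_eval_pi (ε : ι → ℂ[X]) (u : ℂ) :
    AnalyticAt ℂ (fun u i => (ε i).eval u) u := by
  rw [analyticAt_pi_iff]
  exact fun i => AnalyticOnNhd.eval_polynomial (ε i) u (Set.mem_univ u)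

/-- The order at infinity of a vector of polynomials is minus the largest degree. -/
theorem meromorphicOrderAt_eval_inv_zero {ε : ι → ℂ[X]} {m : ℕ} (hle : ∀ i, (ε i).natDegree ≤ m)
    {j : ι} (hj : (ε j).natDegree = m) (hj0 : ε j ≠ 0) :
    MeromorphicAt (fun (u : ℂ) i => (ε i).eval u⁻¹) 0 ∧
    meromorphicOrderAt (fun (u : ℂ) i => (ε i).eval u⁻¹) 0 = ((-m : ℤ) : WithTop ℤ) := by
  -- With reversed coefficients `ε i (1 / u) = u ^ (-m) * g u i`, and `g 0 j` is the leading
  -- coefficient of `ε j`.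
  let g : ℂ → ι → ℂ := fun u i => ((ε i).reflect m).eval u
  have hg : AnalyticAt ℂ g 0 := analyticAt_eval_pi _ 0
  have heq : (fun (u : ℂ) i => (ε i).eval u⁻¹) =ᶠ[𝓝[≠] 0] fun u => (u - 0) ^ (-m : ℤ) • g u := by
    filter_upwards [self_mem_nhdsWithin] with u hu
    have hu : u ≠ 0 := hu
    let _ : Invertible u⁻¹ := invertibleOfNonzero (inv_ne_zero hu)
    ext i
    have := eval₂_reflect_mul_pow (RingHom.id ℂ) u⁻¹ m (ε i) (hle i)
    simp only [invOf_eq_inv, inv_inv] at this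
    simp only [g, sub_zero, Pi.smul_apply, smul_eq_mul, zpow_neg, zpow_natCast]
    rw [eval, ← this, inv_pow, mul_comm]
    rfl
  have hmer : MeromorphicAt (fun (u : ℂ) i => (ε i).eval u⁻¹) 0 := by
    refine MeromorphicAt.congr ?_ heq.symm
    exact ((MeromorphicAt.id 0).sub (MeromorphicAt.const 0 0)).zpow _ |>.smul hg.meromorphicAt
  refine ⟨hmer, (meromorphicOrderAt_eq_int_iff hmer).2 ⟨g, hg, fun h0 => ?_, heq⟩⟩
  have := congrFun h0 j
  simp only [g, Pi.zero_apply, ← coeff_zero_eq_eval_zero, coeff_reflect] at this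
  rw [revAt_le (Nat.zero_le m), Nat.sub_zero, ← hj] at this
  exact hj0 (leadingCoeff_eq_zero.1 this)

/-- A vector valued meromorphic function on the sphere without zeros and poles in the plane is a
vector of polynomials. -/
theorem exists_polynomial_of_meromorphicOrderAt_eq_zero {G : ℂ → ι → ℂ}
    (hG : ∀ w, MeromorphicAt G w) (hord : ∀ w, meromorphicOrderAt G w = 0) {D : ℤ}
    (hinf : MeromorphicAt (fun u => G u⁻¹) 0)
    (hD : meromorphicOrderAt (fun u => G u⁻¹) 0 = ((-D : ℤ) : WithTop ℤ)) :
    ∃ ε : ι → ℂ[X], (∀ w, ∃ i, (ε i).eval w ≠ 0) ∧ (∀ i, ((ε i).natDegree : ℤ) ≤ D) ∧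
      (∃ i, ((ε i).natDegree : ℤ) = D) ∧ ∀ w, AnalyticAt ℂ G w → ∀ i, G w i = (ε i).eval w := by
  -- Passing to the normal form fills the removable singularities; `F` is entire and nowhere zero.
  let F := toMeromorphicNFOn G Set.univ
  have hGon : MeromorphicOn G Set.univ := fun w _ => hG w
  have hNF : ∀ w, MeromorphicNFAt F w := fun w =>
    meromorphicNFOn_toMeromorphicNFOn G Set.univ (Set.mem_univ w)
  have hFG : ∀ w, F =ᶠ[𝓝[≠] w] G := fun w =>
    hGon.toMeromorphicNFOn_eq_self_on_nhdsNE (Set.mem_univ w)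
  have hordF : ∀ w, meromorphicOrderAt F w = 0 := fun w => by
    rw [meromorphicOrderAt_congr (hFG w), hord]
  have hFan : ∀ w, AnalyticAt ℂ F w := fun w =>
    ((hNF w).meromorphicOrderAt_nonneg_iff_analyticAt).1 (hordF w).ge
  have hF0 : ∀ w, F w ≠ 0 := fun w => ((hNF w).meromorphicOrderAt_eq_zero_iff).1 (hordF w)
  have hFGan : ∀ w, AnalyticAt ℂ G w → F w = G w := fun w hw => by
    rw [show F w = toMeromorphicNFAt G w w from
      toMeromorphicNFOn_eq_toMeromorphicNFAt hGon (Set.mem_univ w),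
      toMeromorphicNFAt_eq_self.2 hw.meromorphicNFAt]
  have hFinf : (fun u => F u⁻¹) =ᶠ[𝓝[≠] 0] fun u => G u⁻¹ := by
    filter_upwards [hinf.eventually_analyticAt, self_mem_nhdsWithin] with u hu hu0
    have hu0 : u ≠ 0 := hu0
    refine hFGan _ ?_
    have h1 : AnalyticAt ℂ ((fun u => G u⁻¹) ∘ fun v => v⁻¹) u⁻¹ :=
      AnalyticAt.comp (by simpa using hu) (analyticAt_inv (inv_ne_zero hu0))
    simpa [Function.comp_def] using h1
  have hmerF : MeromorphicAt (fun u => F u⁻¹) 0 := hinf.congr hFinf.symm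
  have hDF : meromorphicOrderAt (fun u => F u⁻¹) 0 = ((-D : ℤ) : WithTop ℤ) := by
    rw [meromorphicOrderAt_congr hFinf, hD]
  obtain ⟨g, hg, hg0, hgF⟩ := (meromorphicOrderAt_eq_int_iff hmerF).1 hDF
  -- The sign of `D` is not known yet, so the growth is bounded by the power `D.toNat`.
  have hO : ∀ i, (fun z => F z i) =O[cocompact ℂ] fun z => z ^ D.toNat := by
    intro i
    have h1 : Tendsto (fun z : ℂ => z⁻¹) (cocompact ℂ) (𝓝[≠] 0) := by
      refine tendsto_nhdsWithin_iff.2 ⟨?_, ?_⟩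
      · exact tendsto_inv₀_cobounded.mono_left (Metric.cobounded_eq_cocompact (α := ℂ)).ge
      · filter_upwards [(isCompact_singleton (x := (0 : ℂ))).compl_mem_cocompact] with z hz
        exact inv_ne_zero hz
    have h2 : ∀ᶠ z : ℂ in cocompact ℂ, F z = z ^ D • g z⁻¹ := by
      filter_upwards [h1.eventually hgF] with z hz
      rw [inv_inv] at hz
      rw [hz, sub_zero, zpow_neg, inv_zpow, inv_inv]
    have h3 : (fun u => g u i) =O[𝓝[≠] 0] fun _ => (1 : ℂ) :=
      ((analyticAt_pi_iff.1 hg i).continuousAt.continuousWithinAt.tendsto).isBigO_one ℂ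
    have h4 := h3.comp_tendsto h1
    have h5 : (fun z : ℂ => z ^ D) =O[cocompact ℂ] fun z => z ^ D.toNat := by
      refine IsBigO.of_bound 1 ?_
      have h1 : ∀ᶠ z : ℂ in cocompact ℂ, 1 ≤ ‖z‖ :=
        (tendsto_norm_cocompact_atTop).eventually_ge_atTop 1
      filter_upwards [h1] with z hz
      rw [one_mul, norm_pow, norm_zpow, ← zpow_natCast]
      exact zpow_le_zpow_right₀ hz (Int.self_le_toNat D)
    refine (h5.mul h4).congr' ?_ ?_
    · filter_upwards [h2] with z hz
      simp [hz]
    · exact Eventually.of_forall fun z => by simp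
  have hdiff : ∀ i, Differentiable ℂ fun z => F z i := fun i z =>
    (analyticAt_pi_iff.1 (hFan z) i).differentiableAt
  choose ε hε using fun i => (hdiff i).exists_polynomial_of_isBigO (hO i)
  have hne : ∀ w, ∃ i, (ε i).eval w ≠ 0 := fun w => by
    by_contra! h
    exact hF0 w (funext fun i => by rw [hε, h, Pi.zero_apply])
  obtain ⟨j₀, hj₀⟩ := hne 0
  have : Nonempty {i // ε i ≠ 0} := ⟨j₀, fun h => hj₀ (by rw [h, eval_zero])⟩
  obtain ⟨⟨j, hj⟩, hmax⟩ := Finite.exists_max fun i : {i // ε i ≠ 0} => (ε i).natDegree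
  have hle : ∀ i, (ε i).natDegree ≤ (ε j).natDegree := fun i => by
    by_cases hi : ε i = 0
    · simp [hi]
    · exact hmax ⟨i, hi⟩
  -- The order at infinity of a polynomial vector is minus its largest degree, and it is also `-D`.
  have hDj : ((ε j).natDegree : ℤ) = D := by
    have h1 := (meromorphicOrderAt_eval_inv_zero hle rfl hj).2
    have h2 : (fun (u : ℂ) i => (ε i).eval u⁻¹) = fun u => F u⁻¹ := by
      ext u i
      rw [hε]
    rw [h2, hDF] at h1
    have := WithTop.coe_injective h1
    omega
  refine ⟨ε, hne, fun i => ?_, ⟨j, hDj⟩, fun w hw i => ?_⟩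
  · have := hle i
    omega
  · rw [← hFGan w hw, hε]

end Entire

/-! ### Orders and ramification transported by the biholomorphic map -/

section Transfer

open RiemannSphere OnePoint Filter

theorem chartAt_coe (z : ℂ) : chartAt ℂ (z : OnePoint ℂ) = affineChart :=
  if_neg (OnePoint.coe_ne_infty z)

theorem chartAt_infty : chartAt ℂ (∞ : OnePoint ℂ) = inftyChart :=
  if_pos rfl

theorem coe_coord {x : OnePoint ℂ} (hx : x ≠ ∞) : (coord x : OnePoint ℂ) = x := by
  induction x using OnePoint.rec with
  | infty => exact absurd rfl hx
  | coe z => rfl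

theorem coord_eq_inv_of_coord_invFun_ne_zero {x : OnePoint ℂ} (hx : coord (invFun x) ≠ 0) :
    coord x = (coord (invFun x))⁻¹ := by
  induction x using OnePoint.rec with
  | infty => simp [invFun_infty] at hx
  | coe z =>
    by_cases hz : z = 0
    · subst hz
      simp [invFun_zero] at hx
    · simp [invFun_coe hz]

/-- A holomorphic map between Riemann surfaces is analytic in charts. -/
theorem ContMDiffAt.analyticAt_charts {X Y : Type*} [TopologicalSpace X] [ChartedSpace ℂ X]
    [TopologicalSpace Y] [ChartedSpace ℂ Y] {f : X → Y} {x : X}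
    (hf : ContMDiffAt 𝓘(ℂ) 𝓘(ℂ) ⊤ f x) :
    AnalyticAt ℂ (fun u => chartAt ℂ (f x) (f ((chartAt ℂ x).symm u))) (chartAt ℂ x x) := by
  have h := (contMDiffAt_iff.1 hf).2
  simp only [modelWithCornersSelf_coe, Set.range_id, contDiffWithinAt_univ] at h
  exact h.analyticAt

variable {M : Type*} [TopologicalSpace M] [ChartedSpace ℂ M]
  (φ : Diffeomorph 𝓘(ℂ) 𝓘(ℂ) (OnePoint ℂ) M ⊤)

theorem Diffeomorph.analyticAt_charts (x : OnePoint ℂ) :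
    AnalyticAt ℂ (fun u => chartAt ℂ (φ x) (φ ((chartAt ℂ x).symm u))) (chartAt ℂ x x) :=
  φ.contMDiff.contMDiffAt.analyticAt_charts

theorem tendsto_chart_symm {X : Type*} [TopologicalSpace X] [ChartedSpace ℂ X] (x : X) :
    Tendsto (chartAt ℂ x).symm (𝓝 (chartAt ℂ x x)) (𝓝 x) := by
  have h := (chartAt ℂ x).continuousAt_symm (mem_chart_target ℂ x)
  rwa [ContinuousAt, (chartAt ℂ x).left_inv (mem_chart_source ℂ x)] at h

theorem Diffeomorph.eventually_chart_symm (x : OnePoint ℂ) :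
    ∀ᶠ u in 𝓝 (chartAt ℂ x x), (chartAt ℂ (φ x)).symm
      (chartAt ℂ (φ x) (φ ((chartAt ℂ x).symm u))) = φ ((chartAt ℂ x).symm u) := by
  have h : Tendsto (fun u => φ ((chartAt ℂ x).symm u)) (𝓝 (chartAt ℂ x x)) (𝓝 (φ x)) :=
    (φ.continuous.tendsto x).comp (tendsto_chart_symm x)
  filter_upwards [h ((chartAt ℂ (φ x)).open_source.mem_nhds (mem_chart_source ℂ (φ x)))] with u hu
  exact (chartAt ℂ (φ x)).left_inv hu

/-- The expression of `φ.symm` in charts is a local left inverse, so the chain rule excludes a zero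
derivative. Orders are therefore invariant under `φ`. -/
theorem Diffeomorph.deriv_charts_ne_zero (x : OnePoint ℂ) :
    deriv (fun u => chartAt ℂ (φ x) (φ ((chartAt ℂ x).symm u))) (chartAt ℂ x x) ≠ 0 := by
  set T := fun u => chartAt ℂ (φ x) (φ ((chartAt ℂ x).symm u)) with hT
  have hTx : T (chartAt ℂ x x) = chartAt ℂ (φ x) (φ x) := by
    simp [hT]
  have hS : AnalyticAt ℂ (fun w => chartAt ℂ x (φ.symm ((chartAt ℂ (φ x)).symm w)))
      (T (chartAt ℂ x x)) := by
    have := (φ.symm.contMDiff.contMDiffAt (x := φ x)).analyticAt_charts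
    rw [hTx]
    simpa using this
  have hid : ∀ᶠ u in 𝓝 (chartAt ℂ x x),
      chartAt ℂ x (φ.symm ((chartAt ℂ (φ x)).symm (T u))) = u := by
    filter_upwards [φ.eventually_chart_symm x,
      (chartAt ℂ x).open_target.mem_nhds (mem_chart_target ℂ x)] with u hu hu'
    rw [hT, hu, φ.symm_apply_apply, (chartAt ℂ x).right_inv hu']
  intro h0
  have hcomp := (hS.differentiableAt.hasDerivAt).comp _
    (φ.analyticAt_charts x).differentiableAt.hasDerivAt
  rw [← hT, h0, mul_zero] at hcomp
  have h1 := hcomp.congr_of_eventuallyEq (f₁ := fun u => u)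
    (by filter_upwards [hid] with u hu; exact hu.symm)
  exact zero_ne_one (h1.unique (hasDerivAt_id _))

theorem Diffeomorph.eventuallyEq_comp_chart {F : Type*} (v : M → F) (x : OnePoint ℂ) :
    (fun u => v (φ ((chartAt ℂ x).symm u))) =ᶠ[𝓝 (chartAt ℂ x x)]
      (fun w => v ((chartAt ℂ (φ x)).symm w)) ∘
        fun u => chartAt ℂ (φ x) (φ ((chartAt ℂ x).symm u)) := by
  filter_upwards [φ.eventually_chart_symm x] with u hu
  rw [Function.comp_apply, hu]

variable {F : Type*} [NormedAddCommGroup F] [NormedSpace ℂ F] {v : M → F}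

theorem IsMeromorphicOn.comp_diffeomorph (hv : IsMeromorphicOn v) (x : OnePoint ℂ) :
    MeromorphicNFAt (fun u => v (φ ((chartAt ℂ x).symm u))) (chartAt ℂ x x) := by
  rw [meromorphicNFAt_congr (φ.eventuallyEq_comp_chart v x),
    meromorphicNFAt_comp_iff_of_deriv_ne_zero (φ.analyticAt_charts x) (φ.deriv_charts_ne_zero x)]
  simpa using hv (φ x)

theorem orderAt_diffeomorph (v : M → F) (x : OnePoint ℂ) :
    orderAt v (φ x) =
      (meromorphicOrderAt (fun u => v (φ ((chartAt ℂ x).symm u))) (chartAt ℂ x x)).untop₀ := by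
  rw [meromorphicOrderAt_congr ((φ.eventuallyEq_comp_chart v x).filter_mono nhdsWithin_le_nhds),
    meromorphicOrderAt_comp_of_deriv_ne_zero (φ.analyticAt_charts x) (φ.deriv_charts_ne_zero x)]
  simp [orderAt]

theorem ramificationIndex_diffeomorph (π : M → OnePoint ℂ) (x : OnePoint ℂ) :
    ramificationIndex π (φ x) = analyticOrderAt (fun u => chartAt ℂ (π (φ x))
      (π (φ ((chartAt ℂ x).symm u))) - chartAt ℂ (π (φ x)) (π (φ x))) (chartAt ℂ x x) := by
  rw [analyticOrderAt_congr (φ.eventuallyEq_comp_chart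
      (fun p => chartAt ℂ (π (φ x)) (π p) - chartAt ℂ (π (φ x)) (π (φ x))) x),
    analyticOrderAt_comp_of_deriv_ne_zero (φ.analyticAt_charts x) (φ.deriv_charts_ne_zero x)]
  simp [ramificationIndex]

theorem meromorphicAt_diffeomorph_inv (hv : IsMeromorphicOn v) :
    MeromorphicAt (fun u : ℂ => v (φ (u⁻¹ : ℂ))) 0 ∧
      orderAt v (φ ∞) = (meromorphicOrderAt (fun u : ℂ => v (φ (u⁻¹ : ℂ))) 0).untop₀ := by
  have h0 : chartAt ℂ (∞ : OnePoint ℂ) ∞ = 0 := by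
    rw [chartAt_infty]
    rfl
  -- The two sides may differ at `u = 0`, where `0⁻¹ = 0` while the chart gives `∞`; the order only
  -- sees a punctured neighbourhood.
  have heq : (fun u => v (φ ((chartAt ℂ (∞ : OnePoint ℂ)).symm u))) =ᶠ[𝓝[≠] 0]
      fun u : ℂ => v (φ (u⁻¹ : ℂ)) := by
    filter_upwards [self_mem_nhdsWithin] with u hu
    rw [chartAt_infty]
    exact congrArg (fun x => v (φ x)) (invFun_coe hu)
  have h1 := (hv.comp_diffeomorph φ ∞).meromorphicAt
  have h2 := orderAt_diffeomorph φ v ∞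
  rw [h0] at h1 h2
  exact ⟨h1.congr heq, by rw [h2, meromorphicOrderAt_congr heq]⟩

theorem meromorphicNFAt_diffeomorph (hv : IsMeromorphicOn v) (w : ℂ) :
    MeromorphicNFAt (fun u : ℂ => v (φ u)) w := by
  have := hv.comp_diffeomorph φ w
  rw [chartAt_coe] at this
  exact this

theorem orderAt_diffeomorph_coe (v : M → F) (w : ℂ) :
    orderAt v (φ w) = (meromorphicOrderAt (fun u : ℂ => v (φ u)) w).untop₀ := by
  have := orderAt_diffeomorph φ v w
  rw [chartAt_coe] at this
  exact this

theorem MeromorphicNFAt.meromorphicOrderAt_eq_zero_of_ne_zero {f : ℂ → F} {w : ℂ}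
    (hf : MeromorphicNFAt f w) (h : f w ≠ 0) : meromorphicOrderAt f w = 0 :=
  hf.meromorphicOrderAt_eq_zero_iff.2 h

/-- The normal form assigns the value `0` at poles as well as at zeros. This makes finiteness of
`zerosPoles` a statement about values. -/
theorem apply_eq_zero_of_mem_zerosPoles (hv : IsMeromorphicOn v) {p : M} (hp : p ∈ zerosPoles v) :
    v p = 0 := by
  by_contra h
  refine hp ?_
  rw [orderAt, (hv p).meromorphicOrderAt_eq_zero_of_ne_zero (by simpa using h)]
  rfl

end Transfer

/-! ### Orders of products of linear factors -/

section Factors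

open Filter

variable {κ : Type*} (s : Finset κ) (a : κ → ℂ) (k : κ → ℤ)

theorem meromorphicAt_prod_zpow (w : ℂ) : MeromorphicAt (fun u => ∏ i ∈ s, (u - a i) ^ k i) w :=
  MeromorphicAt.fun_prod fun i _ => by fun_prop

theorem analyticAt_prod_zpow {w : ℂ} (hw : ∀ i ∈ s, a i ≠ w) :
    AnalyticAt ℂ (fun u => ∏ i ∈ s, (u - a i) ^ k i) w :=
  Finset.analyticAt_fun_prod _ fun i hi =>
    AnalyticAt.fun_zpow (by fun_prop) (sub_ne_zero.2 (hw i hi).symm)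

open Classical in
theorem meromorphicOrderAt_prod_zpow (w : ℂ) :
    meromorphicOrderAt (fun u => ∏ i ∈ s, (u - a i) ^ k i) w =
      ((∑ i ∈ s with a i = w, k i : ℤ) : WithTop ℤ) := by
  rw [meromorphicOrderAt_fun_prod fun i _ => by fun_prop, Finset.sum_filter, WithTop.coe_sum]
  refine Finset.sum_congr rfl fun i _ => ?_
  split_ifs with h
  · rw [h]
    exact meromorphicOrderAt_zpow_id_sub_const
  · refine MeromorphicNFAt.meromorphicOrderAt_eq_zero_of_ne_zero
      (AnalyticAt.meromorphicNFAt ?_) ?_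
    · exact AnalyticAt.fun_zpow (by fun_prop) (sub_ne_zero.2 (Ne.symm h))
    · exact zpow_ne_zero _ (sub_ne_zero.2 (Ne.symm h))

/-- Each factor is `(1 / u - a) ^ k = u ^ (-k) * (1 - a * u) ^ k`, and the last power is analytic
and equal to `1` at `u = 0`. -/
theorem meromorphicOrderAt_prod_zpow_inv :
    MeromorphicAt (fun u : ℂ => ∏ i ∈ s, (u⁻¹ - a i) ^ k i) 0 ∧
    meromorphicOrderAt (fun u : ℂ => ∏ i ∈ s, (u⁻¹ - a i) ^ k i) 0 =
      ((-∑ i ∈ s, k i : ℤ) : WithTop ℤ) := by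
  have hm : ∀ i, MeromorphicAt (fun u : ℂ => (u⁻¹ - a i) ^ k i) 0 := fun i => by fun_prop
  refine ⟨MeromorphicAt.fun_prod fun i _ => hm i, ?_⟩
  rw [meromorphicOrderAt_fun_prod fun i _ => hm i, ← Finset.sum_neg_distrib, WithTop.coe_sum]
  refine Finset.sum_congr rfl fun i _ => ?_
  rw [meromorphicOrderAt_eq_int_iff (hm i)]
  refine ⟨fun u => (1 - a i * u) ^ k i, AnalyticAt.fun_zpow (by fun_prop) (by simp), by simp, ?_⟩
  filter_upwards [self_mem_nhdsWithin] with u hu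
  have hu : u ≠ 0 := hu
  rw [sub_zero, smul_eq_mul, zpow_neg, ← inv_zpow, ← mul_zpow, mul_sub, mul_one, mul_comm (a i),
    inv_mul_cancel_left₀ hu]

end Factors

/-! ### Clearing the zeros and poles of a meromorphic vector -/

section Vectors

open RiemannSphere OnePoint Filter

variable {M : Type*} [TopologicalSpace M] [ChartedSpace ℂ M]
  (φ : Diffeomorph 𝓘(ℂ) 𝓘(ℂ) (OnePoint ℂ) M ⊤) {r : ℕ} {v : M → Fin r → ℂ}

theorem meromorphicOrderAt_ne_top_of_eventually_cofinite {F : Type*} [NormedAddCommGroup F]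
    [NormedSpace ℂ F] {f : ℂ → F} (hf : ∀ᶠ u in cofinite, f u ≠ 0) (w : ℂ) :
    meromorphicOrderAt f w ≠ ⊤ := by
  intro h
  obtain ⟨u, hu, hu'⟩ :=
    ((meromorphicOrderAt_eq_top_iff.1 h).and (hf.filter_mono (nhdsNE_le_cofinite w))).exists
  exact hu' hu

theorem tendsto_diffeomorph_cofinite :
    Tendsto (fun u : ℂ => φ (u : OnePoint ℂ)) cofinite cofinite :=
  (φ.injective.comp (OnePoint.coe_injective)).tendsto_cofinite

theorem finite_zerosPoles (hv : IsMeromorphicOn v) (hne : ∀ᶠ p in cofinite, v p ≠ 0) :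
    (zerosPoles v).Finite :=
  Set.Finite.subset hne fun p hp => by simpa using apply_eq_zero_of_mem_zerosPoles hv hp

theorem coord_symm_eq_iff {p : M} (hp : p ≠ φ ∞) {w : ℂ} :
    coord (φ.symm p) = w ↔ p = φ w := by
  have h1 : φ.symm p ≠ ∞ := fun h => hp (by rw [← h, φ.apply_symm_apply])
  constructor
  · rintro rfl
    rw [coe_coord h1, φ.apply_symm_apply]
  · rintro rfl
    simp

/-- A vector valued meromorphic function on the Riemann surface becomes a vector of polynomials
without common zero after multiplication with the product that clears its zeros and poles. -/
theorem exists_polynomial_vector (hv : IsMeromorphicOn v) (hne : ∀ᶠ p in cofinite, v p ≠ 0) :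
    ∃ ε : Fin r → ℂ[X], (∀ w, ∃ i, (ε i).eval w ≠ 0) ∧
      (∀ i, ((ε i).natDegree : ℤ) ≤ -∑ᶠ p ∈ zerosPoles v, orderAt v p) ∧
      (∃ i, ((ε i).natDegree : ℤ) = -∑ᶠ p ∈ zerosPoles v, orderAt v p) ∧
      ∀ w : ℂ, φ w ∉ zerosPoles v →
        (∏ᶠ p ∈ zerosPoles v \ {φ ∞}, (w - coord (φ.symm p)) ^ (-orderAt v p)) ≠ 0 ∧
        ∀ i, (ε i).eval w =
          (∏ᶠ p ∈ zerosPoles v \ {φ ∞}, (w - coord (φ.symm p)) ^ (-orderAt v p)) * v (φ w) i := by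
  classical
  have hfin := finite_zerosPoles hv hne
  set s : Finset M := hfin.toFinset.erase (φ ∞) with hs
  have hmem : ∀ p, p ∈ s ↔ p ≠ φ ∞ ∧ orderAt v p ≠ 0 := fun p => by
    simp [hs, zerosPoles]
  have hsfin : zerosPoles v \ {φ ∞} = (s : Set M) := by
    ext p
    simp [hs, and_comm]
  have hprod : ∀ w : ℂ, ∏ᶠ p ∈ zerosPoles v \ {φ ∞}, (w - coord (φ.symm p)) ^ (-orderAt v p) =
      ∏ p ∈ s, (w - coord (φ.symm p)) ^ (-orderAt v p) := fun w => by
    rw [hsfin, finprod_mem_coe_finset]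
  have hsum : ∑ᶠ p ∈ zerosPoles v, orderAt v p = orderAt v (φ ∞) + ∑ p ∈ s, orderAt v p := by
    rw [finsum_mem_eq_finite_toFinset_sum _ hfin, hs]
    by_cases h : φ ∞ ∈ hfin.toFinset
    · rw [Finset.add_sum_erase _ _ h]
    · rw [Finset.erase_eq_of_notMem h]
      have : orderAt v (φ ∞) = 0 := by simpa [zerosPoles] using h
      rw [this, zero_add]
  simp only [hprod]
  have hneC : ∀ᶠ u : ℂ in cofinite, v (φ u) ≠ 0 := (tendsto_diffeomorph_cofinite φ).eventually hne
  -- The order is finite because `v` vanishes only at finitely many points, so `untop₀` loses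
  -- nothing.
  have hord : ∀ w : ℂ, meromorphicOrderAt (fun u : ℂ => v (φ u)) w =
      ((orderAt v (φ w) : ℤ) : WithTop ℤ) := fun w => by
    rw [orderAt_diffeomorph_coe,
      WithTop.coe_untop₀_of_ne_top (meromorphicOrderAt_ne_top_of_eventually_cofinite hneC w)]
  have hordinf : meromorphicOrderAt (fun u : ℂ => v (φ (u⁻¹ : ℂ))) 0 =
      ((orderAt v (φ ∞) : ℤ) : WithTop ℤ) := by
    rw [(meromorphicAt_diffeomorph_inv φ hv).2, WithTop.coe_untop₀_of_ne_top]
    exact meromorphicOrderAt_ne_top_of_eventually_cofinite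
      ((inv_injective (G := ℂ)).tendsto_cofinite.eventually hneC) 0
  have hmer : ∀ w, MeromorphicAt (fun u : ℂ => v (φ u)) w := fun w =>
    (meromorphicNFAt_diffeomorph φ hv w).meromorphicAt
  -- The product cancels the order of `v` at every finite point. At infinity it contributes the sum
  -- of the orders over `s`, which together with the order of `v` at `φ ∞` makes the total order.
  obtain ⟨ε, h1, h2, h3, h4⟩ := exists_polynomial_of_meromorphicOrderAt_eq_zero
    (G := fun u => (∏ p ∈ s, (u - coord (φ.symm p)) ^ (-orderAt v p)) • v (φ u))
    (D := -∑ᶠ p ∈ zerosPoles v, orderAt v p)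
    (fun w => (meromorphicAt_prod_zpow s _ _ w).smul (hmer w))
    (fun w => by
      rw [fun_meromorphicOrderAt_smul (meromorphicAt_prod_zpow s _ _ w) (hmer w), hord,
        meromorphicOrderAt_prod_zpow, ← WithTop.coe_add]
      have : ∑ p ∈ s with coord (φ.symm p) = w, -orderAt v p = -orderAt v (φ w) := by
        have h : s.filter (fun p => coord (φ.symm p) = w) = s.filter (fun p => p = φ w) :=
          Finset.filter_congr fun p hp => coord_symm_eq_iff φ ((hmem p).1 hp).1
        rw [h, Finset.sum_filter, Finset.sum_ite_eq']
        split_ifs with hw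
        · rfl
        · rw [hmem] at hw
          have : φ (w : OnePoint ℂ) ≠ φ ∞ := φ.injective.ne (OnePoint.coe_ne_infty w)
          have h0 : orderAt v (φ w) = 0 := by
            by_contra h0
            exact hw ⟨this, h0⟩
          rw [h0, neg_zero]
      rw [this, neg_add_cancel]
      rfl)
    ((meromorphicOrderAt_prod_zpow_inv s _ _).1.smul (meromorphicAt_diffeomorph_inv φ hv).1)
    (by
      rw [fun_meromorphicOrderAt_smul (meromorphicOrderAt_prod_zpow_inv s _ _).1
        (meromorphicAt_diffeomorph_inv φ hv).1, hordinf, (meromorphicOrderAt_prod_zpow_inv s _ _).2,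
        ← WithTop.coe_add, hsum, Finset.sum_neg_distrib, neg_neg, neg_neg, add_comm])
  refine ⟨ε, h1, h2, h3, fun w hw => ?_⟩
  have hws : ∀ p ∈ s, coord (φ.symm p) ≠ w := fun p hp h => by
    rw [coord_symm_eq_iff φ ((hmem p).1 hp).1] at h
    exact hw (h ▸ ((hmem p).1 hp).2)
  refine ⟨Finset.prod_ne_zero_iff.2 fun p hp =>
    zpow_ne_zero _ (sub_ne_zero.2 (hws p hp).symm), fun i => ?_⟩
  have han : AnalyticAt ℂ (fun u : ℂ => v (φ u)) w := by
    refine (meromorphicNFAt_diffeomorph φ hv w).meromorphicOrderAt_nonneg_iff_analyticAt.1 ?_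
    rw [hord, show orderAt v (φ w) = 0 by simpa [zerosPoles] using hw]
    rfl
  rw [← h4 w ((analyticAt_prod_zpow s _ _ hws).smul han) i]
  rfl

end Vectors

/-! ### The projection as a fraction of polynomials -/

section Projection

open RiemannSphere OnePoint Filter

variable {M : Type*} [TopologicalSpace M] [ChartedSpace ℂ M]
  (φ : Diffeomorph 𝓘(ℂ) 𝓘(ℂ) (OnePoint ℂ) M ⊤) {r : ℕ} {π : M → OnePoint ℂ}

theorem analyticAt_proj_charts (hπ : ContMDiff 𝓘(ℂ) 𝓘(ℂ) ⊤ π) (x : OnePoint ℂ) :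
    AnalyticAt ℂ (fun u => chartAt ℂ (π (φ x)) (π (φ ((chartAt ℂ x).symm u)))) (chartAt ℂ x x) :=
  (hπ.comp φ.contMDiff).contMDiffAt.analyticAt_charts (f := π ∘ φ)

theorem analyticAt_proj (hπ : ContMDiff 𝓘(ℂ) 𝓘(ℂ) ⊤ π) {x : OnePoint ℂ} (hx : π (φ x) ≠ ∞) :
    AnalyticAt ℂ (fun u => coord (π (φ ((chartAt ℂ x).symm u)))) (chartAt ℂ x x) := by
  have h := analyticAt_proj_charts φ hπ x
  rw [← coe_coord hx, chartAt_coe] at h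
  exact h

/-- The vector `(1, ϕ)` represents the projection in homogeneous coordinates. It has no zeros, so
clearing its poles yields the denominator and the numerator at once. -/
theorem analyticAt_projVector (hπ : ContMDiff 𝓘(ℂ) 𝓘(ℂ) ⊤ π) {x : OnePoint ℂ}
    (hx : π (φ x) ≠ ∞) :
    AnalyticAt ℂ (fun u => (![1, coord (π (φ ((chartAt ℂ x).symm u)))] : Fin 2 → ℂ))
      (chartAt ℂ x x) := by
  rw [analyticAt_pi_iff]
  intro i
  fin_cases i
  · exact analyticAt_const
  · exact analyticAt_proj φ hπ hx

/-- With `ψ = 1 / ϕ`, which vanishes to the order of ramification, `(1, ϕ) = ψ⁻¹ • (ψ, 1)`, and `(ψ,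
1)` is analytic without zeros. -/
theorem meromorphicOrderAt_projVector_of_eq_infty (hπ : ContMDiff 𝓘(ℂ) 𝓘(ℂ) ⊤ π) {x : OnePoint ℂ}
    (hx : π (φ x) = ∞) {m : ℕ} (hm : (m : ℕ∞) = ramificationIndex π (φ x)) :
    MeromorphicAt (fun u => (![1, coord (π (φ ((chartAt ℂ x).symm u)))] : Fin 2 → ℂ))
      (chartAt ℂ x x) ∧
    meromorphicOrderAt (fun u => (![1, coord (π (φ ((chartAt ℂ x).symm u)))] : Fin 2 → ℂ))
      (chartAt ℂ x x) = ((-m : ℤ) : WithTop ℤ) := by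
  have h := analyticAt_proj_charts φ hπ x
  have hr := ramificationIndex_diffeomorph φ π x
  rw [hx, chartAt_infty] at h hr
  have h0 : inftyChart ∞ = 0 := rfl
  simp only [h0, sub_zero] at hr
  set ψ := fun u => inftyChart (π (φ ((chartAt ℂ x).symm u))) with hψ
  have hord : meromorphicOrderAt ψ (chartAt ℂ x x) = ((m : ℤ) : WithTop ℤ) := by
    rw [h.meromorphicOrderAt_eq, ← hr, ← hm]
    rfl
  have hψ0 : ∀ᶠ u in 𝓝[≠] (chartAt ℂ x x), ψ u ≠ 0 :=
    (meromorphicOrderAt_ne_top_iff_eventually_ne_zero h.meromorphicAt).1 (by rw [hord]; simp)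
  have heq : (fun u => (![1, coord (π (φ ((chartAt ℂ x).symm u)))] : Fin 2 → ℂ))
      =ᶠ[𝓝[≠] (chartAt ℂ x x)] (fun u => ψ⁻¹ u • (![ψ u, 1] : Fin 2 → ℂ)) := by
    filter_upwards [hψ0] with u hu
    have h1 : coord (π (φ ((chartAt ℂ x).symm u))) = (ψ u)⁻¹ :=
      coord_eq_inv_of_coord_invFun_ne_zero hu
    simp [h1, hu]
  have han : AnalyticAt ℂ (fun u => (![ψ u, 1] : Fin 2 → ℂ)) (chartAt ℂ x x) := by
    rw [analyticAt_pi_iff]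
    intro i
    fin_cases i
    · exact h
    · exact analyticAt_const
  refine ⟨(h.meromorphicAt.inv.smul han.meromorphicAt).congr heq.symm, ?_⟩
  rw [meromorphicOrderAt_congr heq,
    fun_meromorphicOrderAt_smul h.meromorphicAt.inv han.meromorphicAt, meromorphicOrderAt_inv, hord,
    han.meromorphicNFAt.meromorphicOrderAt_eq_zero_of_ne_zero (fun h0 => by
      simpa using congrFun h0 1), add_zero]
  rfl

variable {sheet : Fin r → OnePoint ℂ → M}

open Classical in
theorem meromorphicOrderAt_projVector (hπ : ContMDiff 𝓘(ℂ) 𝓘(ℂ) ⊤ π)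
    (hsheet : ListsFibre π ∞ fun k => sheet k ∞) (x : OnePoint ℂ) :
    MeromorphicAt (fun u => (![1, coord (π (φ ((chartAt ℂ x).symm u)))] : Fin 2 → ℂ))
      (chartAt ℂ x x) ∧
    meromorphicOrderAt (fun u => (![1, coord (π (φ ((chartAt ℂ x).symm u)))] : Fin 2 → ℂ))
      (chartAt ℂ x x) = ((-(Finset.univ.filter fun k => sheet k ∞ = φ x).card : ℤ) : WithTop ℤ) := by
  by_cases hx : π (φ x) = ∞
  · refine meromorphicOrderAt_projVector_of_eq_infty φ hπ hx ?_
    rw [← hsheet.2 (φ x) hx, Nat.card_eq_fintype_card, Fintype.card_subtype]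
  · have h := analyticAt_projVector φ hπ hx
    refine ⟨h.meromorphicAt, ?_⟩
    have : (Finset.univ.filter fun k => sheet k ∞ = φ x) = ∅ := by
      refine Finset.filter_false_of_mem fun k _ hk => hx ?_
      rw [← hk]
      exact hsheet.1 k
    rw [this, h.meromorphicNFAt.meromorphicOrderAt_eq_zero_of_ne_zero (fun h0 => by
      simpa using congrFun h0 0)]
    rfl

/-- The projection `ϕ` is the quotient of two polynomials, the larger degree of which is the number
of sheets. -/
theorem exists_polynomial_fraction (hπ : ContMDiff 𝓘(ℂ) 𝓘(ℂ) ⊤ π)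
    (hsheet : ListsFibre π ∞ fun k => sheet k ∞) :
    ∃ A B : ℂ[X], A.natDegree ≤ r ∧ B.natDegree ≤ r ∧ (A.natDegree = r ∨ B.natDegree = r) ∧
      ∀ w : ℂ, π (φ w) ≠ ∞ → B.eval w ≠ 0 ∧ A.eval w = planeProj φ π w * B.eval w ∧
        ∀ n : ℕ, (open Classical in ∏ j ∈ Finset.univ.filter fun j : Fin r => sheet j ∞ ≠ φ ∞,
          (w - coord (φ.symm (sheet j ∞))) ^ n) = B.eval w ^ n := by
  classical
  let s : Finset (Fin r) := Finset.univ.filter fun j : Fin r => sheet j ∞ ≠ φ ∞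
  let a : Fin r → ℂ := fun j => coord (φ.symm (sheet j ∞))
  let H : ℂ → ℂ := fun w => ∏ j ∈ s, (w - a j) ^ (1 : ℤ)
  let f : ℂ → Fin 2 → ℂ := fun u => ![1, coord (π (φ (u : OnePoint ℂ)))]
  have hf : ∀ w : ℂ, MeromorphicAt f w ∧ meromorphicOrderAt f w =
      ((-(Finset.univ.filter fun k => sheet k ∞ = φ w).card : ℤ) : WithTop ℤ) := fun w => by
    have := meromorphicOrderAt_projVector φ hπ hsheet w
    rw [chartAt_coe] at this
    exact this
  have hfinf : MeromorphicAt (fun u => f u⁻¹) 0 ∧ meromorphicOrderAt (fun u => f u⁻¹) 0 =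
      ((-(Finset.univ.filter fun k => sheet k ∞ = φ ∞).card : ℤ) : WithTop ℤ) := by
    have := meromorphicOrderAt_projVector φ hπ hsheet ∞
    rw [chartAt_infty, show inftyChart ∞ = 0 from rfl] at this
    have heq : (fun u => (![1, coord (π (φ (inftyChart.symm u)))] : Fin 2 → ℂ)) =ᶠ[𝓝[≠] 0]
        fun u => f u⁻¹ := by
      filter_upwards [self_mem_nhdsWithin] with u hu
      exact congrArg (fun x => (![1, coord (π (φ x))] : Fin 2 → ℂ)) (invFun_coe hu)
    exact ⟨this.1.congr heq, by rw [← meromorphicOrderAt_congr heq, this.2]⟩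
  -- `H` cancels the poles in the plane, one factor per sheet. At infinity the sheets meeting at `φ
  -- ∞` and the remaining ones add up to order `-r`.
  obtain ⟨ε, h1, h2, h3, h4⟩ := exists_polynomial_of_meromorphicOrderAt_eq_zero
    (G := fun u => H u • f u) (D := r)
    (fun w => (meromorphicAt_prod_zpow s _ _ w).smul (hf w).1)
    (fun w => by
      rw [fun_meromorphicOrderAt_smul (meromorphicAt_prod_zpow s _ _ w) (hf w).1, (hf w).2,
        meromorphicOrderAt_prod_zpow, ← WithTop.coe_add]
      have : s.filter (fun j => a j = w) = Finset.univ.filter fun k => sheet k ∞ = φ w := by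
        ext j
        simp only [s, a, Finset.mem_filter, Finset.mem_univ, true_and]
        constructor
        · rintro ⟨hj, hjw⟩
          exact (coord_symm_eq_iff φ hj).1 hjw
        · intro hj
          have : sheet j ∞ ≠ φ ∞ := by
            rw [hj]
            exact φ.injective.ne (OnePoint.coe_ne_infty w)
          exact ⟨this, (coord_symm_eq_iff φ this).2 hj⟩
      rw [this, Finset.sum_const, nsmul_eq_mul, mul_one, add_neg_cancel]
      rfl)
    ((meromorphicOrderAt_prod_zpow_inv s _ _).1.smul hfinf.1)
    (by
      rw [fun_meromorphicOrderAt_smul (meromorphicOrderAt_prod_zpow_inv s _ _).1 hfinf.1, hfinf.2,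
        (meromorphicOrderAt_prod_zpow_inv s _ _).2, ← WithTop.coe_add]
      have : (Finset.univ.filter fun k => sheet k ∞ = φ ∞).card + s.card = r := by
        have h := Finset.card_filter_add_card_filter_not (s := (Finset.univ : Finset (Fin r)))
          (fun k => sheet k ∞ = φ ∞)
        rw [Finset.card_univ, Fintype.card_fin] at h
        convert h
      congr 1
      simp only [Finset.sum_const, nsmul_eq_mul, mul_one]
      omega)
  have hdeg : (ε 1).natDegree = r ∨ (ε 0).natDegree = r := by
    obtain ⟨i, hi⟩ := h3
    fin_cases i
    · exact Or.inr (by exact_mod_cast hi)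
    · exact Or.inl (by exact_mod_cast hi)
  refine ⟨ε 1, ε 0, by exact_mod_cast h2 1, by exact_mod_cast h2 0, hdeg, fun w hw => ?_⟩
  have haw : ∀ j ∈ s, a j ≠ w := fun j hj h => by
    rw [coord_symm_eq_iff φ (Finset.mem_filter.1 hj).2] at h
    exact hw (h ▸ hsheet.1 j)
  have hfan : AnalyticAt ℂ f w := by
    have := analyticAt_projVector φ hπ hw
    rw [chartAt_coe] at this
    exact this
  have h5 := h4 w ((analyticAt_prod_zpow s a _ haw).smul hfan)
  have hB : (ε 0).eval w = H w := by
    rw [← h5 0]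
    simp [f]
  refine ⟨?_, ?_, fun n => ?_⟩
  · rw [hB]
    exact Finset.prod_ne_zero_iff.2 fun j hj => zpow_ne_zero _ (sub_ne_zero.2 (haw j hj).symm)
  · rw [hB, ← h5 1]
    simp [f, planeProj, mul_comm]
  · rw [hB]
    simp only [H, zpow_one, Finset.prod_pow]
    rfl

end Projection

/-! ### Generic fibres of the spectral surface -/

section Generic

open RiemannSphere OnePoint Filter

variable {M : Type*} [TopologicalSpace M] [ChartedSpace ℂ M] {r : ℕ}
  {W : Matrix (Fin r) (Fin r) (RatFunc ℂ)} {E : ℂ → Matrix (Fin r) (Fin r) ℂ} {Lam : ℂ → Fin r → ℂ}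
  {π : M → OnePoint ℂ} {sheet : Fin r → OnePoint ℂ → M} {lam : M → ℂ} {e einv : M → Fin r → ℂ}
  {φ : Diffeomorph 𝓘(ℂ) 𝓘(ℂ) (OnePoint ℂ) M ⊤}

theorem ramificationIndex_ne_zero (φ : Diffeomorph 𝓘(ℂ) 𝓘(ℂ) (OnePoint ℂ) M ⊤)
    (hπ : ContMDiff 𝓘(ℂ) 𝓘(ℂ) ⊤ π) (p : M) : ramificationIndex π p ≠ 0 := by
  obtain ⟨x, rfl⟩ : ∃ x, φ x = p := φ.surjective p
  rw [ramificationIndex_diffeomorph, analyticOrderAt_ne_zero]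
  exact ⟨(analyticAt_proj_charts φ hπ x).sub analyticAt_const, by simp⟩

theorem ListsFibre.exists_eq (φ : Diffeomorph 𝓘(ℂ) 𝓘(ℂ) (OnePoint ℂ) M ⊤)
    (hπ : ContMDiff 𝓘(ℂ) 𝓘(ℂ) ⊤ π) {z : OnePoint ℂ} {x : Fin r → M} (hx : ListsFibre π z x) {p : M}
    (hp : π p = z) : ∃ k, x k = p := by
  have h1 := hx.2 p hp
  have h2 : Nat.card {k // x k = p} ≠ 0 := fun h0 => by
    rw [h0] at h1
    exact ramificationIndex_ne_zero φ hπ p h1.symm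
  obtain ⟨⟨k, hk⟩⟩ := (Nat.card_ne_zero.1 h2).1
  exact ⟨k, hk⟩

/-- Two lists of the same fibre agree up to order. -/
theorem ListsFibre.sum_eq {z : OnePoint ℂ} {x y : Fin r → M} (hx : ListsFibre π z x)
    (hy : ListsFibre π z y) (f : M → ℂ) : ∑ k, f (x k) = ∑ k, f (y k) := by
  classical
  have key : ∀ x : Fin r → M, ListsFibre π z x → ∀ p, π p = z →
      (((Finset.univ.val.map x).count p : ℕ) : ℕ∞) = ramificationIndex π p := by
    intro x hx p hp
    rw [← hx.2 p hp, Multiset.count_map, Nat.card_eq_fintype_card, Fintype.card_subtype]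
    simp only [eq_comm (a := p)]
    rfl
  have hne : ∀ x : Fin r → M, ListsFibre π z x → ∀ p, π p ≠ z →
      (Finset.univ.val.map x).count p = 0 := by
    intro x hx p hp
    rw [Multiset.count_eq_zero, Multiset.mem_map]
    rintro ⟨k, -, hk⟩
    exact hp (hk ▸ hx.1 k)
  have h : Finset.univ.val.map x = Finset.univ.val.map y := by
    ext p
    by_cases hp : π p = z
    · exact_mod_cast (key x hx p hp).trans (key y hy p hp).symm
    · rw [hne x hx p hp, hne y hy p hp]
  have h2 := congrArg (fun m => (m.map f).sum) h
  simp only [Multiset.map_map] at h2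
  exact h2

/-- Fibres are finite, since every point over `z` occurs in the list of sheets; hence finite
exceptional sets pull back to finite sets. -/
theorem eventually_cofinite_of_proj (φ : Diffeomorph 𝓘(ℂ) 𝓘(ℂ) (OnePoint ℂ) M ⊤)
    (hπ : ContMDiff 𝓘(ℂ) 𝓘(ℂ) ⊤ π) (hs : ∀ z, ListsFibre π z fun k => sheet k z) {P : ℂ → Prop}
    (hP : ∀ᶠ z in cofinite, P z) : ∀ᶠ p in cofinite, π p ≠ ∞ ∧ P (coord (π p)) := by
  have hfib : ∀ z, (π ⁻¹' {z}).Finite := fun z =>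
    (Set.finite_range fun k => sheet k z).subset fun p hp => (hs z).exists_eq φ hπ hp
  have hfin : (⋃ z ∈ insert ∞ ((↑) '' {z | ¬P z} : Set (OnePoint ℂ)), π ⁻¹' {z}).Finite :=
    Set.Finite.biUnion ((Set.Finite.image _ hP).insert _) fun z _ => hfib z
  refine hfin.subset fun p hp => ?_
  simp only [Set.mem_iUnion, Set.mem_preimage, Set.mem_singleton_iff, exists_prop, exists_eq_right']
  by_cases h : π p = ∞
  · exact Or.inl h
  · refine Or.inr ⟨coord (π p), fun hPp => hp ⟨h, hPp⟩, coe_coord h⟩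

/-- All properties that hold for all but finitely many points of the plane. -/
structure IsGenericSpectralPoint (W : Matrix (Fin r) (Fin r) (RatFunc ℂ))
    (E : ℂ → Matrix (Fin r) (Fin r) ℂ) (Lam : ℂ → Fin r → ℂ)
    (π : M → OnePoint ℂ) (sheet : Fin r → OnePoint ℂ → M)
    (lam : M → ℂ) (e einv : M → Fin r → ℂ)
    (φ : Diffeomorph 𝓘(ℂ) 𝓘(ℂ) (OnePoint ℂ) M ⊤) (z : ℂ) : Prop where
  isUnit : IsUnit (E z)
  diagonalization : evalRat W z = E z * Matrix.diagonal (Lam z) * (E z)⁻¹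
  lam_sheet : ∀ k, lam (sheet k z) = Lam z k
  e_sheet : ∀ k i, e (sheet k z) i = E z i k
  einv_sheet : ∀ k i, einv (sheet k z) i = (E z)⁻¹ k i
  ne_proj : (z : OnePoint ℂ) ≠ π (φ ∞)
  regular_e : ∀ p, π p = z → p ∉ zerosPoles e
  regular_einv : ∀ p, π p = z → p ∉ zerosPoles einv

/-- A zero of `e` or `einv` over a generic point would be a zero column of `E` or a zero row of
`E⁻¹`. -/
theorem IsSpectralSurface.eventually_e_ne_zero
    (hM : IsSpectralSurface W E Lam π sheet lam e einv)
    (φ : Diffeomorph 𝓘(ℂ) 𝓘(ℂ) (OnePoint ℂ) M ⊤) :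
    (∀ᶠ p in cofinite, e p ≠ 0) ∧ ∀ᶠ p in cofinite, einv p ≠ 0 := by
  constructor
  · filter_upwards [eventually_cofinite_of_proj φ hM.holomorphic hM.sheets
      (hM.diagonalization.and hM.e_sheet)] with p hp h0
    obtain ⟨hp1, ⟨hu, -⟩, he⟩ := hp
    obtain ⟨k, hk⟩ := (hM.sheets (π p)).exists_eq φ hM.holomorphic (p := p) rfl
    rw [Matrix.isUnit_iff_isUnit_det] at hu
    refine hu.ne_zero (Matrix.det_eq_zero_of_column_eq_zero k fun i => ?_)
    rw [← he, coe_coord hp1, hk, h0, Pi.zero_apply]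
  · filter_upwards [eventually_cofinite_of_proj φ hM.holomorphic hM.sheets
      (hM.diagonalization.and hM.einv_sheet)] with p hp h0
    obtain ⟨hp1, ⟨hu, -⟩, he⟩ := hp
    obtain ⟨k, hk⟩ := (hM.sheets (π p)).exists_eq φ hM.holomorphic (p := p) rfl
    rw [← Matrix.isUnit_nonsing_inv_iff, Matrix.isUnit_iff_isUnit_det] at hu
    refine hu.ne_zero (Matrix.det_eq_zero_of_row_eq_zero k fun i => ?_)
    rw [← he, coe_coord hp1, hk, h0, Pi.zero_apply]

theorem IsSpectralSurface.eventually_isGenericSpectralPoint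
    (hM : IsSpectralSurface W E Lam π sheet lam e einv)
    (φ : Diffeomorph 𝓘(ℂ) 𝓘(ℂ) (OnePoint ℂ) M ⊤) :
    ∀ᶠ z in cofinite, IsGenericSpectralPoint W E Lam π sheet lam e einv φ z := by
  have h1 : ∀ x : OnePoint ℂ, ∀ᶠ z : ℂ in cofinite, (z : OnePoint ℂ) ≠ x := fun x =>
    (OnePoint.coe_injective.tendsto_cofinite).eventually
      (Set.finite_singleton x).compl_mem_cofinite
  have h2 : ∀ v : M → Fin r → ℂ, (zerosPoles v).Finite →
      ∀ᶠ z : ℂ in cofinite, ∀ p, π p = z → p ∉ zerosPoles v := fun v hv => by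
    have h := (OnePoint.coe_injective (X := ℂ)).tendsto_cofinite.eventually
      (hv.image π).compl_mem_cofinite
    filter_upwards [h] with z hz p hp hpv
    exact hz ⟨p, hpv, hp⟩
  have hne := hM.eventually_e_ne_zero φ
  filter_upwards [hM.diagonalization, hM.lam_sheet, hM.e_sheet, hM.einv_sheet, h1 (π (φ ∞)),
    h2 e (finite_zerosPoles hM.meromorphic_e hne.1),
    h2 einv (finite_zerosPoles hM.meromorphic_einv hne.2)] with z a1 a2 a3 a4 a5 a6 a7
  exact ⟨a1.1, a1.2, a2, a3, a4, a5, a6, a7⟩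

variable {z : ℂ}

/-- Coinciding sheets would give two equal columns of the invertible matrix `E z`. -/
theorem IsGenericSpectralPoint.sheet_injective
    (hz : IsGenericSpectralPoint W E Lam π sheet lam e einv φ z) : Function.Injective fun k => sheet k z := by
  intro k l hkl
  by_contra hne
  have hu := hz.isUnit
  rw [Matrix.isUnit_iff_isUnit_det] at hu
  refine hu.ne_zero (Matrix.det_zero_of_column_eq hne fun i => ?_)
  rw [← hz.e_sheet, ← hz.e_sheet]
  exact congrArg (fun p => e p i) hkl

theorem IsGenericSpectralPoint.ne_infty
    (hz : IsGenericSpectralPoint W E Lam π sheet lam e einv φ z) {p : M} (hp : π p = z) : p ≠ φ ∞ := by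
  rintro rfl
  exact hz.ne_proj hp.symm

theorem IsGenericSpectralPoint.apply_coord
    (hz : IsGenericSpectralPoint W E Lam π sheet lam e einv φ z) {p : M} (hp : π p = z) : φ (coord (φ.symm p)) = p :=
  ((coord_symm_eq_iff φ (hz.ne_infty hp)).1 rfl).symm

theorem analyticAt_planeProj (hπ : ContMDiff 𝓘(ℂ) 𝓘(ℂ) ⊤ π) {w : ℂ} (hw : π (φ w) ≠ ∞) :
    AnalyticAt ℂ (planeProj φ π) w := by
  have := analyticAt_proj φ hπ hw
  rw [chartAt_coe] at this
  exact this

/-- The sheets over `z` are distinct, so the ramification index is `1` and `ϕ - z` has a simple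
zero. -/
theorem IsGenericSpectralPoint.deriv_planeProj_ne_zero
    (hz : IsGenericSpectralPoint W E Lam π sheet lam e einv φ z)
    (hM : IsSpectralSurface W E Lam π sheet lam e einv) {w : ℂ} (hw : π (φ w) = z) :
    deriv (planeProj φ π) w ≠ 0 := by
  have hw' : π (φ w) ≠ ∞ := hw.trans_ne (OnePoint.coe_ne_infty z)
  have han := analyticAt_planeProj hM.holomorphic hw'
  have h1 : ramificationIndex π (φ w) = 1 := by
    have h := (hM.sheets z).2 (φ w) hw
    obtain ⟨k, hk⟩ := (hM.sheets z).exists_eq φ hM.holomorphic hw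
    have : Unique {k // sheet k z = φ w} :=
      ⟨⟨⟨k, hk⟩⟩, fun l => Subtype.ext (hz.sheet_injective (l.2.trans hk.symm))⟩
    rw [← h, Nat.card_unique]
    rfl
  rw [ramificationIndex_diffeomorph, hw, chartAt_coe, chartAt_coe] at h1
  have h2 : analyticOrderAt (fun u => planeProj φ π u - planeProj φ π w) w = 1 := by
    rw [← h1]
    have : planeProj φ π w = coord (z : OnePoint ℂ) := by rw [planeProj, hw]
    rw [this]
    rfl
  rw [← han.analyticOrderAt_deriv_add_one] at h2
  have h3 : analyticOrderAt (deriv (planeProj φ π)) w = 0 := by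
    generalize analyticOrderAt (deriv (planeProj φ π)) w = m at h2
    induction m using ENat.recTopCoe with
    | top => simp at h2
    | coe m =>
      norm_cast at h2 ⊢
      omega
  exact (han.deriv.analyticOrderAt_eq_zero).1 h3

/-- The pairings of `einv` on sheet `k` with `e` on sheet `l` are the entries of `E⁻¹ E = 1`; the
clearing factors are nonzero. -/
theorem IsGenericSpectralPoint.isDualFibre
    (hz : IsGenericSpectralPoint W E Lam π sheet lam e einv φ z)
    (hM : IsSpectralSurface W E Lam π sheet lam e einv) {A B : ℂ[X]} {ε ε' : Fin r → ℂ[X]} {h h' : ℂ → ℂ}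
    (hAB : ∀ w : ℂ, π (φ w) ≠ ∞ → B.eval w ≠ 0 ∧ A.eval w = planeProj φ π w * B.eval w)
    (hε : ∀ w : ℂ, φ w ∉ zerosPoles e → h w ≠ 0 ∧ ∀ i, (ε i).eval w = h w * e (φ w) i)
    (hε' : ∀ w : ℂ, φ w ∉ zerosPoles einv → h' w ≠ 0 ∧ ∀ i, (ε' i).eval w = h' w * einv (φ w) i) :
    IsDualFibre A B ε ε' z fun k => coord (φ.symm (sheet k z)) := by
  have hs : ∀ k, π (sheet k z) = z := (hM.sheets z).1
  have hx : ∀ k, φ (coord (φ.symm (sheet k z))) = sheet k z := fun k => hz.apply_coord (hs k)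
  have hπ : ∀ k, π (φ (coord (φ.symm (sheet k z)))) = z := fun k => by rw [hx, hs]
  have hπ' : ∀ k, π (φ (coord (φ.symm (sheet k z)))) ≠ ∞ := fun k =>
    (hπ k).trans_ne (OnePoint.coe_ne_infty z)
  have hE := hz.isUnit
  rw [Matrix.isUnit_iff_isUnit_det] at hE
  have key : ∀ k l, ∑ i, (ε' i).eval (coord (φ.symm (sheet k z))) *
      (ε i).eval (coord (φ.symm (sheet l z))) =
        h' (coord (φ.symm (sheet k z))) * h (coord (φ.symm (sheet l z))) *
          (1 : Matrix (Fin r) (Fin r) ℂ) k l := fun k l => by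
    rw [← Matrix.nonsing_inv_mul _ hE, Matrix.mul_apply, Finset.mul_sum]
    refine Finset.sum_congr rfl fun i _ => ?_
    rw [(hε _ (hz.regular_e _ (hπ l))).2, (hε' _ (hz.regular_einv _ (hπ k))).2, hx, hx, hz.e_sheet,
      hz.einv_sheet]
    ring
  exact
  { injective := fun k l hkl => hz.sheet_injective (by
      have := congrArg (fun w : ℂ => φ (w : OnePoint ℂ)) hkl
      simpa only [hx] using this)
    denom_ne_zero := fun k => (hAB _ (hπ' k)).1
    eval_eq := fun k => by
      rw [(hAB _ (hπ' k)).2, planeProj, hπ, coord_coe]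
    off_diag := fun k l hkl => by
      rw [key, Matrix.one_apply_ne hkl, mul_zero]
    diag := fun k => by
      rw [key, Matrix.one_apply_eq, mul_one]
      exact mul_ne_zero (hε' _ (hz.regular_einv _ (hπ k))).1 (hε _ (hz.regular_e _ (hπ k))).1 }

end Generic

/-! ### Reproducing kernels as inverses of moment matrices -/

section Moments

variable {n m : ℕ} {Γ : Contour n m}

theorem Contour.HasIntegral.sum {ι : Type*} (s : Finset ι) {g : ι → ℂ → ℂ} {v : ι → ℂ}
    (h : ∀ q ∈ s, Γ.HasIntegral (g q) (v q)) (c : ι → ℂ) :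
    Γ.HasIntegral (fun w => ∑ q ∈ s, c q * g q w) (∑ q ∈ s, c q * v q) := by
  have heq : ∀ i t, ∑ j, (∑ q ∈ s, c q * g q (Γ.curve i j t)) *
      derivWithin (Γ.curve i j) (Γ.dom i) t =
        ∑ q ∈ s, c q * ∑ j, g q (Γ.curve i j t) * derivWithin (Γ.curve i j) (Γ.dom i) t := by
    intro i t
    simp only [Finset.sum_mul, Finset.mul_sum, mul_assoc]
    exact Finset.sum_comm
  refine ⟨fun i => ?_, ?_⟩
  · simp only [heq]
    exact MeasureTheory.integrable_finsetSum s fun q hq => ((h q hq).1 i).const_mul (c q)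
  · simp only [heq]
    have : ∀ i, ∫ t in Γ.dom i, ∑ q ∈ s, c q * ∑ j, g q (Γ.curve i j t) *
        derivWithin (Γ.curve i j) (Γ.dom i) t = ∑ q ∈ s, c q * ∫ t in Γ.dom i,
          ∑ j, g q (Γ.curve i j t) * derivWithin (Γ.curve i j) (Γ.dom i) t := by
      intro i
      rw [MeasureTheory.integral_finsetSum s fun q hq => ((h q hq).1 i).const_mul (c q)]
      exact Finset.sum_congr rfl fun q _ => MeasureTheory.integral_const_mul _ _
    simp only [this]
    rw [Finset.sum_comm]
    exact Finset.sum_congr rfl fun q hq => by rw [← Finset.mul_sum, (h q hq).2]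

theorem Contour.HasIntegral.unique {g : ℂ → ℂ} {v v' : ℂ} (h : Γ.HasIntegral g v)
    (h' : Γ.HasIntegral g v') : v = v' :=
  h.2.symm.trans h'.2

theorem Contour.hasIntegral_zero : Γ.HasIntegral (fun _ => 0) 0 := by
  simpa using Contour.HasIntegral.sum (Γ := Γ) (∅ : Finset ℕ) (g := fun _ _ => 0) (v := fun _ => 0)
    (by simp) (fun _ => 0)

/-- Sampling at `z = 0, …, N - 1` and inverting the Vandermonde matrix isolates each coefficient,
convergence included. -/
theorem Contour.HasIntegral.of_forall_pow {N : ℕ} {F : Fin N → ℂ → ℂ} {v : Fin N → ℂ}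
    (h : ∀ z : ℂ, Γ.HasIntegral (fun w => ∑ c : Fin N, z ^ (c : ℕ) * F c w)
      (∑ c : Fin N, z ^ (c : ℕ) * v c))
    (c : Fin N) : Γ.HasIntegral (F c) (v c) := by
  let V : Matrix (Fin N) (Fin N) ℂ := Matrix.vandermonde fun s => ((s : ℕ) : ℂ)
  have hV : IsUnit V.det := (Matrix.det_vandermonde_ne_zero_iff.2 fun a b hab => by
    exact Fin.ext (by exact_mod_cast hab)).isUnit
  have key : ∀ f : Fin N → ℂ, ∑ s, V⁻¹ c s * ∑ d : Fin N, ((s : ℕ) : ℂ) ^ (d : ℕ) * f d = f c := by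
    intro f
    have h1 := congrFun (congrArg (fun A => Matrix.mulVec A f) (Matrix.nonsing_inv_mul V hV)) c
    simp only [← Matrix.mulVec_mulVec, Matrix.one_mulVec] at h1
    exact h1
  have := Contour.HasIntegral.sum Finset.univ
    (fun (s : Fin N) _ => h ((s : ℕ) : ℂ)) (fun s : Fin N => V⁻¹ c s)
  simpa only [key] using this

/-- If the columns of `F * A` have the unit vectors as integrals, then `A` is invertible and the
integral of `F` is its inverse. -/
theorem Contour.HasIntegral.inverse {ι : Type*} [Fintype ι] [DecidableEq ι] {F : ι → ι → ℂ → ℂ}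
    {A : Matrix ι ι ℂ}
    (h : ∀ p q, Γ.HasIntegral (fun w => ∑ s, F p s w * A s q) ((1 : Matrix ι ι ℂ) p q)) :
    A.det ≠ 0 ∧ ∀ p s, Γ.HasIntegral (F p s) (A⁻¹ p s) := by
  have key : ∀ (p : ι) (x : ι → ℂ),
      Γ.HasIntegral (fun w => ∑ s, F p s w * (A.mulVec x) s) (x p) := by
    intro p x
    have h1 := Contour.HasIntegral.sum Finset.univ (fun q _ => h p q) x
    have h2 : ∀ w, ∑ q, x q * ∑ s, F p s w * A s q = ∑ s, F p s w * (A.mulVec x) s := by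
      intro w
      simp only [Matrix.mulVec, dotProduct, Finset.mul_sum]
      rw [Finset.sum_comm]
      exact Finset.sum_congr rfl fun s _ => Finset.sum_congr rfl fun q _ => by ring
    simpa only [h2, Matrix.one_apply, mul_ite, mul_one, mul_zero, Finset.sum_ite_eq,
      Finset.mem_univ, if_true] using h1
  -- For a null vector `x` of `A` the integrand is identically zero, while its integral is `x p`.
  have hdet : A.det ≠ 0 := fun h0 => by
    obtain ⟨x, hx, hAx⟩ := Matrix.exists_mulVec_eq_zero_iff.2 h0
    refine hx (funext fun p => ?_)
    have h1 := key p x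
    simp only [hAx, Pi.zero_apply, mul_zero, Finset.sum_const_zero] at h1
    exact h1.unique Contour.hasIntegral_zero
  refine ⟨hdet, fun p s => ?_⟩
  -- This choice isolates `F p s`, whose own convergence was not assumed.
  have h1 := key p (A⁻¹.mulVec (Pi.single s 1))
  rw [Matrix.mulVec_mulVec, Matrix.mul_nonsing_inv _ hdet.isUnit, Matrix.one_mulVec] at h1
  simpa [Pi.single_apply, Matrix.mulVec_single] using h1

/-- The coefficients of a kernel as a block matrix. -/
noncomputable def kernelMatrix {r : ℕ} (N : ℕ) (R : Matrix (Fin r) (Fin r) ℂ[X][X]) :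
    Matrix (Fin r × Fin N) (Fin r × Fin N) ℂ :=
  Matrix.of fun p q => ((R p.1 q.1).coeff p.2).coeff q.2

theorem eval_eq_sum_fin {S : Type*} [CommRing S] {N : ℕ} {p : S[X]}
    (hp : p ∈ Polynomial.degreeLT S N) (x : S) :
    p.eval x = ∑ a : Fin N, p.coeff a * x ^ (a : ℕ) := by
  rw [Fin.sum_univ_eq_sum_range (fun a => p.coeff a * x ^ a)]
  by_cases hp0 : p = 0
  · simp [hp0]
  · exact Polynomial.eval_eq_sum_range'
      ((Polynomial.natDegree_lt_iff_degree_lt hp0).2 (Polynomial.mem_degreeLT.1 hp)) x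

theorem eval_eval_eq_sum {N : ℕ} {q : ℂ[X][X]} (hq : q ∈ Polynomial.degreeLT ℂ[X] N)
    (hq' : ∀ k, q.coeff k ∈ Polynomial.degreeLT ℂ N) (w z : ℂ) :
    (q.eval (Polynomial.C w)).eval z =
      ∑ a : Fin N, ∑ c : Fin N, (q.coeff a).coeff c * (w ^ (a : ℕ) * z ^ (c : ℕ)) := by
  rw [eval_eq_sum_fin hq, Polynomial.eval_finsetSum]
  refine Finset.sum_congr rfl fun a _ => ?_
  rw [Polynomial.eval_mul, eval_eq_sum_fin (hq' a), Polynomial.eval_pow, Polynomial.eval_C,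
    Finset.sum_mul]
  exact Finset.sum_congr rfl fun c _ => by ring

/-- The coefficient matrix of a Christoffel-Darboux kernel is the inverse of the matrix of
moments. -/
theorem IsCDKernel.moments {r N : ℕ} {W : ℂ → Matrix (Fin r) (Fin r) ℂ}
    {R : Matrix (Fin r) (Fin r) ℂ[X][X]} (hR : IsCDKernel Γ W N R) :
    (kernelMatrix N R).det ≠ 0 ∧ ∀ p s : Fin r × Fin N,
      Γ.HasIntegral (fun w => w ^ (p.2 + s.2 : ℕ) * W w p.1 s.1) ((kernelMatrix N R)⁻¹ p s) := by
  have hRe : ∀ w z i j, evalKernel R w z i j = ∑ a : Fin N, ∑ c : Fin N,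
      kernelMatrix N R (i, a) (j, c) * (w ^ (a : ℕ) * z ^ (c : ℕ)) := fun w z i j =>
    eval_eval_eq_sum (hR.1 i j).1 (hR.1 i j).2 w z
  have hX : ∀ (k : Fin r) (d : Fin N) (i j : Fin r),
      Matrix.single k k (Polynomial.X ^ (d : ℕ) : ℂ[X]) i j ∈ Polynomial.degreeLT ℂ N := by
    intro k d i j
    rw [Matrix.single_apply]
    split_ifs
    · rw [Polynomial.mem_degreeLT, Polynomial.degree_X_pow]
      exact_mod_cast d.2
    · exact Submodule.zero_mem _
  have hmap : ∀ (k : Fin r) (d : Fin N) (w : ℂ),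
      (Matrix.single k k (Polynomial.X ^ (d : ℕ) : ℂ[X])).map (Polynomial.eval w) =
        Matrix.single k k (w ^ (d : ℕ)) := by
    intro k d w
    ext i j
    simp only [Matrix.map_apply, Matrix.single_apply]
    split_ifs <;> simp
  have hval : ∀ (k : Fin r) (d : Fin N) (j : Fin r) (z : ℂ),
      (if k = j then z ^ (d : ℕ) else 0) =
        ∑ c : Fin N, z ^ (c : ℕ) *
          (1 : Matrix (Fin r × Fin N) (Fin r × Fin N) ℂ) (k, d) (j, c) := by
    intro k d j z
    by_cases hkj : k = j
    · simp [Matrix.one_apply, hkj]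
    · simp [hkj]
  rcases hR.2 with h | h
  · refine Contour.HasIntegral.inverse ?_
    rintro ⟨k, d⟩ ⟨j, c⟩
    refine Contour.HasIntegral.of_forall_pow (F := fun c w => ∑ s : Fin r × Fin N,
      w ^ (d + s.2 : ℕ) * W w k s.1 * kernelMatrix N R s (j, c))
      (v := fun c => (1 : Matrix (Fin r × Fin N) (Fin r × Fin N) ℂ) (k, d) (j, c)) (fun z => ?_) c
    have h1 := h _ (hX k d) z k j
    rw [Matrix.single_apply] at h1
    simp only [true_and, apply_ite (Polynomial.eval z), Polynomial.eval_pow, Polynomial.eval_X,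
      Polynomial.eval_zero, hval, hmap] at h1
    convert h1 using 1
    ext w
    rw [mul_assoc, Matrix.single_mul_apply_same, Matrix.mul_apply]
    simp only [hRe, Fintype.sum_prod_type, Finset.mul_sum]
    rw [Finset.sum_comm]
    refine Finset.sum_congr rfl fun i _ => ?_
    rw [Finset.sum_comm]
    refine Finset.sum_congr rfl fun a _ => Finset.sum_congr rfl fun c _ => ?_
    rw [pow_add]
    ring
  -- The formula with the kernel on the left is the previous case for the transposed matrices.
  · have h2 := Contour.HasIntegral.inverse (Γ := Γ) (A := (kernelMatrix N R).transpose)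
      (F := fun p s w => w ^ (s.2 + p.2 : ℕ) * W w s.1 p.1) (by
      rintro ⟨k, d⟩ ⟨j, c⟩
      refine Contour.HasIntegral.of_forall_pow (F := fun c w => ∑ s : Fin r × Fin N,
        w ^ (s.2 + d : ℕ) * W w s.1 k * (kernelMatrix N R).transpose s (j, c))
        (v := fun c => (1 : Matrix (Fin r × Fin N) (Fin r × Fin N) ℂ) (k, d) (j, c))
        (fun z => ?_) c
      have h1 := h _ (hX k d) z j k
      rw [Matrix.single_apply] at h1
      simp only [and_true, apply_ite (Polynomial.eval z), Polynomial.eval_pow, Polynomial.eval_X,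
        Polynomial.eval_zero, hval, hmap] at h1
      convert h1 using 1
      ext w
      rw [Matrix.mul_single_apply_same, Matrix.mul_apply]
      simp only [hRe, Fintype.sum_prod_type, Finset.mul_sum, Finset.sum_mul, Matrix.transpose_apply]
      rw [Finset.sum_comm]
      refine Finset.sum_congr rfl fun i _ => ?_
      rw [Finset.sum_comm]
      rw [Finset.sum_comm]
      refine Finset.sum_congr rfl fun a _ => Finset.sum_congr rfl fun c _ => ?_
      rw [pow_add]
      ring)
    refine ⟨by simpa using h2.1, fun p s => ?_⟩
    have h3 := h2.2 s p
    rwa [← Matrix.transpose_nonsing_inv, Matrix.transpose_apply] at h3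

end Moments

/-! ### Change of variables along the lifted contour -/

section PlaneContour

open RiemannSphere OnePoint Filter MeasureTheory

/-- `derivWithin` defaults to `0` where derivatives within the set are not unique. -/
theorem uniqueDiffWithinAt_of_derivWithin_ne_zero {f : ℝ → ℂ} {s : Set ℝ} {t : ℝ}
    (h : derivWithin f s t ≠ 0) : UniqueDiffWithinAt ℝ s t := by
  by_contra hu
  exact h (derivWithin_zero_of_not_uniqueDiffWithinAt hu)

/-- A curve with nonzero derivative takes a given value at isolated times, and a discrete set of
reals is countable. Finitely many exceptional points therefore cost only a null set of times. -/
theorem Contour.IsSmooth.countable_preimage {n m : ℕ} {Γ : Contour n m} (hΓ : Γ.IsSmooth)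
    (i : Fin n) (j : Fin m) (z : ℂ) : {t ∈ Γ.dom i | Γ.curve i j t = z}.Countable := by
  have hd : DiscreteTopology {t ∈ Γ.dom i | Γ.curve i j t = z} := by
    rw [discreteTopology_subtype_iff]
    rintro t ⟨ht, htz⟩
    obtain ⟨h1, h2⟩ := (hΓ i).2 j
    have h3 := ((h1.differentiableOn (by simp)) t ht).hasDerivWithinAt.eventually_ne (c := z)
      (h2 t ht)
    rw [inf_principal_eq_bot]
    rw [eventually_nhdsWithin_iff] at h3
    refine eventually_nhdsWithin_iff.2 (h3.mono fun x hx hxt hxS => ?_)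
    exact hx ⟨hxS.1, hxt⟩ hxS.2
  exact Set.countable_coe_iff.1 (TopologicalSpace.separableSpace_iff_countable.1 inferInstance)

theorem Contour.IsSmooth.ae_restrict {n m : ℕ} {Γ : Contour n m} (hΓ : Γ.IsSmooth)
    {P : ℂ → Prop} (hP : ∀ᶠ z in cofinite, P z) (i : Fin n) (j : Fin m) :
    ∀ᵐ t ∂volume.restrict (Γ.dom i), t ∈ Γ.dom i ∧ P (Γ.curve i j t) := by
  have hc : {t ∈ Γ.dom i | ¬P (Γ.curve i j t)}.Countable := by
    refine (Set.Finite.countable hP).biUnion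
      (t := fun z _ => {t ∈ Γ.dom i | Γ.curve i j t = z}) (fun z _ => hΓ.countable_preimage i j z)
      |>.mono fun t ht => ?_
    simp only [Set.mem_iUnion]
    exact ⟨_, ht.2, ht.1, rfl⟩
  have hm : MeasurableSet (Γ.dom i) := (hΓ i).1.measurableSet
  rw [ae_restrict_iff' hm]
  have h0 := hc.measure_zero volume
  rw [measure_eq_zero_iff_ae_notMem] at h0
  filter_upwards [h0] with t ht htd
  exact ⟨htd, by_contra fun hn => ht ⟨htd, hn⟩⟩

variable {M : Type*} [TopologicalSpace M] [ChartedSpace ℂ M] {r : ℕ}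
  {W : Matrix (Fin r) (Fin r) (RatFunc ℂ)} {E : ℂ → Matrix (Fin r) (Fin r) ℂ} {Lam : ℂ → Fin r → ℂ}
  {π : M → OnePoint ℂ} {sheet : Fin r → OnePoint ℂ → M} {lam : M → ℂ} {e einv : M → Fin r → ℂ}
  {φ : Diffeomorph 𝓘(ℂ) 𝓘(ℂ) (OnePoint ℂ) M ⊤}

/-- The derivative of a lift of a curve along the projection. -/
theorem IsGenericSpectralPoint.deriv_mul_derivWithin {z : ℂ}
    (hz : IsGenericSpectralPoint W E Lam π sheet lam e einv φ z)
    (hM : IsSpectralSurface W E Lam π sheet lam e einv)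
    {c : ℝ → ℂ} {l : ℝ → M} {s : Set ℝ} {t : ℝ} (ht : t ∈ s) (hc : DifferentiableWithinAt ℝ c s t)
    (hc' : derivWithin c s t ≠ 0) (hl : ContinuousWithinAt l s t)
    (hlc : ∀ t ∈ s, π (l t) = c t) (hzt : c t = z) :
    deriv (planeProj φ π) (coord (φ.symm (l t))) *
      derivWithin (fun t => coord (φ.symm (l t))) s t = derivWithin c s t := by
  have hlt : π (l t) = z := by rw [hlc t ht, hzt]
  have hφ : φ (coord (φ.symm (l t))) = l t := hz.apply_coord hlt
  have hw : π (φ (coord (φ.symm (l t)))) = z := by rw [hφ, hlt]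
  have hd := hz.deriv_planeProj_ne_zero hM hw
  have hst := (analyticAt_planeProj hM.holomorphic
    (hw.trans_ne (OnePoint.coe_ne_infty z))).hasStrictDerivAt
  have hne : φ.symm (l t) ≠ ∞ := fun h => hz.ne_infty hlt (by rw [← h, φ.apply_symm_apply])
  have hcont : ContinuousWithinAt (fun t => φ.symm (l t)) s t :=
    φ.symm.continuous.continuousAt.comp_continuousWithinAt hl
  have hev : ∀ᶠ x in 𝓝[s] t, φ.symm (l x) ≠ ∞ :=
    hcont (isOpen_compl_singleton.mem_nhds hne)
  have hcc : ContinuousWithinAt (fun t => coord (φ.symm (l t))) s t :=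
    ContinuousAt.comp_continuousWithinAt (f := fun t => φ.symm (l t))
      (affineChart.continuousAt hne) hcont
  have hproj : ∀ᶠ x in 𝓝[s] t, planeProj φ π (coord (φ.symm (l x))) = c x := by
    filter_upwards [hev, self_mem_nhdsWithin] with x hx hxs
    rw [planeProj, coe_coord hx, φ.apply_symm_apply, hlc x hxs, coord_coe]
  have hpt : planeProj φ π (coord (φ.symm (l t))) = c t := by
    rw [planeProj, hw, coord_coe, hzt]
  -- The lift is only assumed continuous; near `t` it is the local inverse of `ϕ` applied to the
  -- base curve, hence differentiable.
  have hinv : ∀ᶠ x in 𝓝[s] t, coord (φ.symm (l x)) =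
      hst.localInverse _ _ _ hd (c x) := by
    filter_upwards [hproj, hcc (hst.eventually_left_inverse hd)] with x hx hx'
    rw [← hx]
    exact hx'.symm
  have hg := (hst.to_localInverse hd).hasDerivAt
  rw [hpt] at hg
  have hcomp := (hg.comp_hasDerivWithinAt t hc.hasDerivWithinAt).congr_of_eventuallyEq hinv
    (hinv.self_of_nhdsWithin ht)
  rw [hcomp.derivWithin (uniqueDiffWithinAt_of_derivWithin_ne_zero hc'),
    mul_inv_cancel_left₀ hd]

variable {n : ℕ} {γ : Contour n 1} {lift : Fin n → Fin r → ℝ → M}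

/-- Integrals over the contour in the plane of functions that are, up to the factor `ϕ'`, the
pullback of a function on the surface. -/
theorem Contour.HasIntegral.pullback (hγ : γ.IsSmooth)
    (hM : IsSpectralSurface W E Lam π sheet lam e einv) (hlift : IsLiftedContour π γ lift)
    {f : M → ℂ} {g : ℂ → ℂ} {G : ℂ → ℂ} {v : ℂ} (hv : γ.HasIntegral g v)
    (hG : ∀ z, IsGenericSpectralPoint W E Lam π sheet lam e einv φ z → ∀ u : ℂ, π (φ u) = z →
      G u = f (φ u) * deriv (planeProj φ π) u)
    (hg : ∀ z : ℂ, IsGenericSpectralPoint W E Lam π sheet lam e einv φ z →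
      ∑ k, f (sheet k z) = g z) :
    (planeContour φ γ lift).HasIntegral G v := by
  have hae : ∀ i, (fun t => ∑ j, g (γ.curve i j t) * derivWithin (γ.curve i j) (γ.dom i) t)
      =ᵐ[volume.restrict (γ.dom i)] fun t => ∑ j, G ((planeContour φ γ lift).curve i j t) *
        derivWithin ((planeContour φ γ lift).curve i j) ((planeContour φ γ lift).dom i) t := by
    intro i
    filter_upwards [hγ.ae_restrict (hM.eventually_isGenericSpectralPoint φ) i 0] with t ht
    obtain ⟨htd, hz⟩ := ht
    have hL := (hlift i).2 t htd
    obtain ⟨h1, h2⟩ := (hγ i).2 0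
    -- The lifts list the fibre in an order that may differ from that of the sheets; the sum does
    -- not depend on it.
    rw [Fin.sum_univ_one, ← hg _ hz, ← hL.sum_eq (hM.sheets _), Finset.sum_mul]
    refine Finset.sum_congr rfl fun j _ => ?_
    have hφ : φ (coord (φ.symm (lift i j t))) = lift i j t := hz.apply_coord (hL.1 j)
    change _ = G (coord (φ.symm (lift i j t))) *
      derivWithin (fun t => coord (φ.symm (lift i j t))) (γ.dom i) t
    rw [hG _ hz _ (by rw [hφ, hL.1 j]), hφ, mul_assoc,
      hz.deriv_mul_derivWithin hM htd (h1.differentiableOn (by simp) t htd) (h2 t htd)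
        ((hlift i).1 j t htd) (fun t ht => ((hlift i).2 t ht).1 j) rfl]
  refine ⟨fun i => (hv.1 i).congr (hae i), ?_⟩
  rw [← hv.2]
  exact Finset.sum_congr rfl fun i _ => (integral_congr_ae (hae i)).symm

end PlaneContour

/-! ### Bivariate kernels with a prescribed coefficient matrix -/

section BivariateKernel

open Polynomial

variable {ι : Type*} [Fintype ι] (A : Matrix ι ι ℂ) (b' b : ι → ℂ[X])

/-- The bivariate polynomial `∑ p q, A p q * b' p (u) * b q (ζ)`. -/
noncomputable def bivariateKernel : ℂ[X][X] :=
  ∑ p, ∑ q, (b' p).map C * C (C (A p q) * b q)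

theorem eval_bivariateKernel (u : ℂ) :
    (bivariateKernel A b' b).eval (C u) = ∑ q, (∑ p, (b' p).eval u * A p q) • b q := by
  have h : ∀ p, ((b' p).map C).eval (C u) = C ((b' p).eval u) := fun p => by
    rw [eval_map, eval₂_at_apply]
  simp only [bivariateKernel, eval_finsetSum, eval_mul, h, eval_C, Finset.sum_smul, smul_eq_C_mul,
    C_mul]
  rw [Finset.sum_comm]
  exact Finset.sum_congr rfl fun q _ => Finset.sum_congr rfl fun p _ => by ring

theorem eval_eval_bivariateKernel (u ζ : ℂ) :
    ((bivariateKernel A b' b).eval (C u)).eval ζ =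
      ∑ p, ∑ q, (b' p).eval u * A p q * (b q).eval ζ := by
  rw [eval_bivariateKernel, eval_finsetSum, Finset.sum_comm]
  exact Finset.sum_congr rfl fun q _ => by rw [eval_smul, smul_eq_mul, Finset.sum_mul]

theorem map_bivariateKernel (ζ : ℂ) :
    (bivariateKernel A b' b).map (evalRingHom ζ) = ∑ p, (∑ q, A p q * (b q).eval ζ) • b' p := by
  have h : ((evalRingHom ζ).comp C : ℂ →+* ℂ) = RingHom.id ℂ := by
    ext
    simp
  simp only [bivariateKernel, Polynomial.map_sum, Polynomial.map_mul, Polynomial.map_map, h,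
    Polynomial.map_id, map_C, Finset.sum_smul]
  refine Finset.sum_congr rfl fun p _ => Finset.sum_congr rfl fun q _ => ?_
  rw [coe_evalRingHom, eval_mul, eval_C, smul_eq_C_mul, mul_comm]

theorem coeff_bivariateKernel (k : ℕ) :
    (bivariateKernel A b' b).coeff k = ∑ p, ∑ q, ((b' p).coeff k * A p q) • b q := by
  simp only [bivariateKernel, finsetSum_coeff]
  refine Finset.sum_congr rfl fun p _ => Finset.sum_congr rfl fun q _ => ?_
  rw [coeff_mul_C, coeff_map, smul_eq_C_mul, C_mul, mul_assoc]

variable {A b' b}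

theorem bivariateKernel_mem_degreeLT {d : ℕ} (hb' : ∀ p, b' p ∈ degreeLT ℂ d)
    (hb : ∀ q, b q ∈ degreeLT ℂ d) :
    bivariateKernel A b' b ∈ degreeLT ℂ[X] d ∧
      ∀ k, (bivariateKernel A b' b).coeff k ∈ degreeLT ℂ d := by
  constructor
  · rw [mem_degreeLT, degree_lt_iff_coeff_zero]
    intro k hk
    rw [coeff_bivariateKernel]
    refine Finset.sum_eq_zero fun p _ => Finset.sum_eq_zero fun q _ => ?_
    rw [(degree_lt_iff_coeff_zero _ _).1 (mem_degreeLT.1 (hb' p)) k hk, zero_mul, zero_smul]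
  · intro k
    rw [coeff_bivariateKernel]
    exact Submodule.sum_mem _ fun p _ => Submodule.sum_mem _ fun q _ =>
      Submodule.smul_mem _ _ (hb q)

/-- The coefficient of `ζ ^ m` is the combination of the `b' p` with weights `A` times the vector of
`m`-th coefficients of `b`. Independence of `b'` and invertibility of `A` make that vector zero, so
no cancellation can hide a large degree. -/
theorem mem_degreeLT_of_coeff_bivariateKernel [DecidableEq ι] (hA : A.det ≠ 0)
    (hb' : LinearIndependent ℂ b') {d : ℕ}
    (h : ∀ k, (bivariateKernel A b' b).coeff k ∈ degreeLT ℂ d) (q : ι) : b q ∈ degreeLT ℂ d := by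
  rw [mem_degreeLT, degree_lt_iff_coeff_zero]
  intro m hm
  have h1 : A.mulVec (fun q => (b q).coeff m) = 0 := by
    refine funext (Fintype.linearIndependent_iff.1 hb' _ ?_)
    ext k
    have h2 := (degree_lt_iff_coeff_zero _ _).1 (mem_degreeLT.1 (h k)) m hm
    rw [coeff_bivariateKernel] at h2
    simp only [finsetSum_coeff, coeff_smul, smul_eq_mul] at h2
    rw [finsetSum_coeff, coeff_zero, ← h2]
    refine Finset.sum_congr rfl fun p _ => ?_
    rw [coeff_smul, smul_eq_mul, Matrix.mulVec, dotProduct, Finset.sum_mul]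
    exact Finset.sum_congr rfl fun q _ => by ring
  exact congrFun (Matrix.eq_zero_of_mulVec_eq_zero hA h1) q

variable {n m : ℕ} {Γ : Contour n m} {w : ℂ → ℂ} [DecidableEq ι]

/-- On coordinate vectors the integral is multiplication by the moment matrix `A⁻¹`, which cancels
the `A` in the kernel. -/
theorem hasIntegral_mul_bivariateKernel (hA : A.det ≠ 0)
    (hw : ∀ p q, Γ.HasIntegral (fun u => (b p).eval u * w u * (b' q).eval u) (A⁻¹ p q))
    {f : ℂ[X]} (hf : f ∈ Submodule.span ℂ (Set.range b)) (ζ : ℂ) :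
    Γ.HasIntegral (fun u => f.eval u * w u * ((bivariateKernel A b' b).eval (C u)).eval ζ)
      (f.eval ζ) := by
  obtain ⟨x, rfl⟩ := (Submodule.mem_span_range_iff_exists_fun ℂ).1 hf
  let B : ι → ℂ := fun q => (b q).eval ζ
  convert Contour.HasIntegral.sum Finset.univ (fun (k : ι × ι) _ => hw k.1 k.2)
    (fun k => x k.1 * (A.mulVec B) k.2) using 1
  · ext u
    rw [eval_eval_bivariateKernel]
    simp only [eval_finsetSum, eval_smul, smul_eq_mul, Fintype.sum_prod_type, Finset.sum_mul]
    refine Finset.sum_congr rfl fun k _ => ?_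
    simp only [Matrix.mulVec, dotProduct, Finset.mul_sum, Finset.sum_mul, B]
    exact Finset.sum_congr rfl fun p _ => Finset.sum_congr rfl fun q _ => by ring
  · have h1 : A⁻¹.mulVec (A.mulVec B) = B := by
      rw [Matrix.mulVec_mulVec, Matrix.nonsing_inv_mul _ hA.isUnit, Matrix.one_mulVec]
    simp only [eval_finsetSum, eval_smul, smul_eq_mul, Fintype.sum_prod_type]
    refine Finset.sum_congr rfl fun k _ => ?_
    rw [show eval ζ (b k) = B k from rfl, ← congrFun h1 k, Matrix.mulVec, dotProduct,
      Finset.mul_sum]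
    exact Finset.sum_congr rfl fun p _ => by ring

theorem hasIntegral_bivariateKernel_mul (hA : A.det ≠ 0)
    (hw : ∀ p q, Γ.HasIntegral (fun u => (b p).eval u * w u * (b' q).eval u) (A⁻¹ p q))
    {f : ℂ[X]} (hf : f ∈ Submodule.span ℂ (Set.range b')) (u : ℂ) :
    Γ.HasIntegral (fun ζ => ((bivariateKernel A b' b).eval (C u)).eval ζ * w ζ * f.eval ζ)
      (f.eval u) := by
  obtain ⟨x, rfl⟩ := (Submodule.mem_span_range_iff_exists_fun ℂ).1 hf
  let B : ι → ℂ := fun q => (b' q).eval u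
  convert Contour.HasIntegral.sum Finset.univ (fun (k : ι × ι) _ => hw k.1 k.2)
    (fun k => (A.vecMul B) k.1 * x k.2) using 1
  · ext ζ
    have h1 : ((bivariateKernel A b' b).eval (C u)).eval ζ =
        ∑ q, (A.vecMul B) q * (b q).eval ζ := by
      rw [eval_bivariateKernel, eval_finsetSum]
      exact Finset.sum_congr rfl fun q _ => by rw [eval_smul, smul_eq_mul]; rfl
    rw [h1, eval_finsetSum, Finset.sum_mul, Finset.sum_mul_sum, Fintype.sum_prod_type]
    refine Finset.sum_congr rfl fun q _ => Finset.sum_congr rfl fun l _ => ?_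
    rw [eval_smul, smul_eq_mul]
    ring
  · have h1 : A⁻¹.vecMul (A.vecMul B) = B := by
      rw [Matrix.vecMul_vecMul, Matrix.mul_nonsing_inv _ hA.isUnit, Matrix.vecMul_one]
    simp only [eval_finsetSum, eval_smul, smul_eq_mul, Fintype.sum_prod_type]
    rw [Finset.sum_comm]
    refine Finset.sum_congr rfl fun l _ => ?_
    rw [show eval u (b' l) = B l from rfl, ← congrFun h1 l, Matrix.vecMul, dotProduct,
      Finset.mul_sum]
    exact Finset.sum_congr rfl fun p _ => by ring

end BivariateKernel

/-! ### Bases of the polynomial spaces and the scalar moments -/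

section PolySpace

open RiemannSphere OnePoint Filter

variable {M : Type*} [TopologicalSpace M] [ChartedSpace ℂ M] {r N : ℕ}
  {π : M → OnePoint ℂ} {sheet : Fin r → OnePoint ℂ → M}
  {φ : Diffeomorph 𝓘(ℂ) 𝓘(ℂ) (OnePoint ℂ) M ⊤}

theorem infinite_regularPoints (hπ : ContMDiff 𝓘(ℂ) 𝓘(ℂ) ⊤ π)
    (hs : ∀ z, ListsFibre π z fun k => sheet k z) {v : M → Fin r → ℂ} (hv : IsMeromorphicOn v)
    (hne : ∀ᶠ p in cofinite, v p ≠ 0) : (regularPoints φ π v).Infinite := by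
  have h := (eventually_cofinite_of_proj φ hπ hs (P := fun _ => True) (by simp)).and
    (finite_zerosPoles hv hne).compl_mem_cofinite
  have h' : ∀ᶠ u : ℂ in cofinite, u ∈ regularPoints φ π v := by
    filter_upwards [(tendsto_diffeomorph_cofinite φ).eventually h] with u hu
    exact ⟨hu.1.1, hu.2⟩
  have := (Set.Finite.infinite_compl (s := (regularPoints φ π v)ᶜ) h')
  rwa [compl_compl] at this

variable {v : M → Fin r → ℂ} {b : Fin r × Fin N → ℂ[X]}

/-- On the regular points, `b (i, a)` is the function `ϕ ^ a * v i` times the clearing factor. -/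
def RepresentsBasis (φ : Diffeomorph 𝓘(ℂ) 𝓘(ℂ) (OnePoint ℂ) M ⊤) (π : M → OnePoint ℂ)
    (sheet : Fin r → OnePoint ℂ → M) (v : M → Fin r → ℂ) (b : Fin r × Fin N → ℂ[X]) : Prop :=
  ∀ w ∈ regularPoints φ π v, ∀ q, (b q).eval w =
    coord (π (φ w)) ^ (q.2 : ℕ) * v (φ w) q.1 * clearing φ sheet v N w

theorem RepresentsBasis.eval_sum (hb : RepresentsBasis φ π sheet v b) {P : Fin r → ℂ[X]}
    (hP : ∀ i, P i ∈ Polynomial.degreeLT ℂ N) {w : ℂ} (hw : w ∈ regularPoints φ π v) :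
    (∑ q, (P q.1).coeff q.2 • b q).eval w =
      (∑ i, (P i).eval (coord (π (φ w))) * v (φ w) i) * clearing φ sheet v N w := by
  simp only [Polynomial.eval_finsetSum, Polynomial.eval_smul, smul_eq_mul, hb w hw,
    Fintype.sum_prod_type, eval_eq_sum_fin (hP _), Finset.sum_mul]
  exact Finset.sum_congr rfl fun i _ => Finset.sum_congr rfl fun a _ => by ring

theorem RepresentsBasis.exists_of_mem (hb : RepresentsBasis φ π sheet v b) {f : M → ℂ}
    (hf : f ∈ meroSpace π v N) : ∃ p ∈ polySpace φ π sheet v N,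
      ∀ ζ ∈ regularPoints φ π v, p.eval ζ = f (φ ζ) * clearing φ sheet v N ζ := by
  obtain ⟨P, hP, rfl⟩ := id hf
  have h := fun w hw => hb.eval_sum hP (w := w) hw
  exact ⟨_, ⟨_, hf, h⟩, h⟩

theorem RepresentsBasis.polySpace_eq_span (hb : RepresentsBasis φ π sheet v b)
    (hinf : (regularPoints φ π v).Infinite) :
    polySpace φ π sheet v N = Submodule.span ℂ (Set.range b) := by
  refine le_antisymm ?_ (Submodule.span_le.2 ?_)
  · rintro p ⟨_, ⟨P, hP, rfl⟩, hp⟩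
    have : p = ∑ q, (P q.1).coeff q.2 • b q :=
      Polynomial.eq_of_infinite_eval_eq _ _ (hinf.mono fun w hw =>
        (hp w hw).trans (hb.eval_sum hP hw).symm)
    rw [this]
    exact Submodule.sum_mem _ fun q _ => Submodule.smul_mem _ _ (Submodule.subset_span ⟨q, rfl⟩)
  · rintro _ ⟨q, rfl⟩
    refine ⟨fun p => coord (π p) ^ (q.2 : ℕ) * v p q.1,
      ⟨Pi.single q.1 (Polynomial.X ^ (q.2 : ℕ)), fun i => ?_, ?_⟩, fun w hw => hb w hw q⟩
    · rw [Pi.single_apply]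
      split_ifs
      · rw [Polynomial.mem_degreeLT, Polynomial.degree_X_pow]
        exact_mod_cast q.2.2
      · exact Submodule.zero_mem _
    · ext p
      rw [Finset.sum_eq_single q.1 (fun i _ hi => by simp [hi]) (by simp)]
      simp

theorem isScalarKernel_bivariateKernel {e einv : M → Fin r → ℂ} {b' : Fin r × Fin N → ℂ[X]}
    (hb : RepresentsBasis φ π sheet e b) (hb' : RepresentsBasis φ π sheet einv b')
    {R : Matrix (Fin r) (Fin r) ℂ[X][X]}
    (hR : ∀ i j, R i j ∈ Polynomial.degreeLT ℂ[X] N ∧ ∀ k, (R i j).coeff k ∈ Polynomial.degreeLT ℂ N) :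
    IsScalarKernel φ π sheet e einv N R (bivariateKernel (kernelMatrix N R) b' b) := by
  intro u hu ζ hζ
  rw [eval_eval_bivariateKernel]
  have hRe : ∀ i j, evalKernel R (planeProj φ π u) (planeProj φ π ζ) i j =
      ∑ a : Fin N, ∑ c : Fin N, kernelMatrix N R (i, a) (j, c) *
        (coord (π (φ u)) ^ (a : ℕ) * coord (π (φ ζ)) ^ (c : ℕ)) := fun i j =>
    eval_eval_eq_sum (hR i j).1 (hR i j).2 _ _
  simp only [hb ζ hζ, hb' u hu, Fintype.sum_prod_type, dotProduct, Matrix.mulVec, hRe,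
    Finset.mul_sum, Finset.sum_mul]
  refine Finset.sum_congr rfl fun i _ => ?_
  rw [Finset.sum_comm]
  refine Finset.sum_congr rfl fun j _ => Finset.sum_congr rfl fun a _ =>
    Finset.sum_congr rfl fun c _ => ?_
  ring

theorem IsScalarKernel.unique {e einv : M → Fin r → ℂ} {R : Matrix (Fin r) (Fin r) ℂ[X][X]}
    {K K' : ℂ[X][X]} (hinf : (regularPoints φ π e).Infinite)
    (hinf' : (regularPoints φ π einv).Infinite) (hK : IsScalarKernel φ π sheet e einv N R K)
    (hK' : IsScalarKernel φ π sheet e einv N R K') : K' = K := by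
  refine Polynomial.eq_of_infinite_eval_eq _ _
    ((hinf'.image (Polynomial.C_injective (R := ℂ)).injOn).mono ?_)
  rintro _ ⟨u, hu, rfl⟩
  exact Polynomial.eq_of_infinite_eval_eq _ _ (hinf.mono fun ζ hζ =>
    (hK' u hu ζ hζ).trans (hK u hu ζ hζ).symm)

variable {W : Matrix (Fin r) (Fin r) (RatFunc ℂ)} {E : ℂ → Matrix (Fin r) (Fin r) ℂ}
  {Lam : ℂ → Fin r → ℂ} {lam : M → ℂ} {e einv : M → Fin r → ℂ} {b' : Fin r × Fin N → ℂ[X]}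
  {n : ℕ} {γ : Contour n 1} {lift : Fin n → Fin r → ℝ → M}

/-- The moments of the scalar weight in the plane are those of the matrix weight. -/
theorem hasIntegral_scalarWeight (hγ : γ.IsSmooth)
    (hM : IsSpectralSurface W E Lam π sheet lam e einv) (hlift : IsLiftedContour π γ lift)
    (hb : RepresentsBasis φ π sheet e b) (hb' : RepresentsBasis φ π sheet einv b')
    (hc : ∀ w ∈ regularPoints φ π e, clearing φ sheet e N w ≠ 0)
    (hc' : ∀ w ∈ regularPoints φ π einv, clearing φ sheet einv N w ≠ 0)
    {p s : Fin r × Fin N} {x : ℂ}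
    (hx : γ.HasIntegral (fun w => w ^ (p.2 + s.2 : ℕ) * evalRat W w p.1 s.1) x) :
    (planeContour φ γ lift).HasIntegral
      (fun u => (b p).eval u * scalarWeight φ π sheet lam e einv N u * (b' s).eval u) x := by
  refine Contour.HasIntegral.pullback hγ hM hlift
    (f := fun P => coord (π P) ^ (p.2 + s.2 : ℕ) * (e P p.1 * lam P * einv P s.1)) hx ?_ ?_
  · intro z hz u hu
    have hr : u ∈ regularPoints φ π e :=
      ⟨hu.trans_ne (OnePoint.coe_ne_infty z), hz.regular_e _ hu⟩
    have hr' : u ∈ regularPoints φ π einv :=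
      ⟨hu.trans_ne (OnePoint.coe_ne_infty z), hz.regular_einv _ hu⟩
    rw [hb u hr, hb' u hr', scalarWeight]
    have h1 := hc u hr
    have h2 := hc' u hr'
    field_simp
    ring
  · intro z hz
    -- The entry of `E * diagonal Lam * E⁻¹` is the sum over the sheets of `e * lam * einv`.
    rw [hz.diagonalization, Matrix.mul_apply, Finset.mul_sum]
    refine Finset.sum_congr rfl fun k _ => ?_
    rw [(hM.sheets z).1 k, coord_coe, hz.e_sheet, hz.lam_sheet, hz.einv_sheet,
      Matrix.mul_diagonal]

/-- On regular points the clearing factor is `B ^ (N - 1)` times the product that turns `v` into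
`ε`, and `ϕ ^ a * B ^ (N - 1) = A ^ a * B ^ (N - 1 - a)`. -/
theorem exists_representsBasis {A B : ℂ[X]} (hAB : ∀ w : ℂ, π (φ w) ≠ ∞ →
      B.eval w ≠ 0 ∧ A.eval w = planeProj φ π w * B.eval w ∧
        ∀ n : ℕ, (open Classical in ∏ j ∈ Finset.univ.filter fun j : Fin r => sheet j ∞ ≠ φ ∞,
          (w - coord (φ.symm (sheet j ∞))) ^ n) = B.eval w ^ n) {ε : Fin r → ℂ[X]}
    (hε : ∀ w : ℂ, φ w ∉ zerosPoles v →
        (∏ᶠ p ∈ zerosPoles v \ {φ ∞}, (w - coord (φ.symm p)) ^ (-orderAt v p)) ≠ 0 ∧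
        ∀ i, (ε i).eval w =
          (∏ᶠ p ∈ zerosPoles v \ {φ ∞}, (w - coord (φ.symm p)) ^ (-orderAt v p)) * v (φ w) i) :
    RepresentsBasis φ π sheet v (homogenized A B ε N) ∧
      ∀ w ∈ regularPoints φ π v, clearing φ sheet v N w ≠ 0 := by
  have hcl : ∀ w ∈ regularPoints φ π v, clearing φ sheet v N w = B.eval w ^ (N - 1) *
      ∏ᶠ p ∈ zerosPoles v \ {φ ∞}, (w - coord (φ.symm p)) ^ (-orderAt v p) := fun w hw => by
    rw [clearing, (hAB w hw.1).2.2]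
  refine ⟨fun w hw q => ?_, fun w hw => ?_⟩
  · rw [eval_homogenized (hAB w hw.1).2.1, (hε w hw.2).2, hcl w hw, planeProj]
    ring
  · rw [hcl w hw]
    exact mul_ne_zero (pow_ne_zero _ (hAB w hw.1).1) (hε w hw.2).1

end PolySpace

/-! ### The main theorem -/

theorem mainTheorem1 {r N n : ℕ} (hN : 0 < N)
    (γ : Contour n 1) (hγ : γ.IsSmooth)
    (W : Matrix (Fin r) (Fin r) (RatFunc ℂ)) (hW : NoPoleOn W γ)
    (R : Matrix (Fin r) (Fin r) ℂ[X][X]) (hR : IsCDKernel γ (evalRat W) N R)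
    {M : Type*} [TopologicalSpace M] [ChartedSpace ℂ M] [IsManifold 𝓘(ℂ) ⊤ M]
    (π : M → OnePoint ℂ) (sheet : Fin r → OnePoint ℂ → M)
    (E : ℂ → Matrix (Fin r) (Fin r) ℂ) (Lam : ℂ → Fin r → ℂ)
    (lam : M → ℂ) (e einv : M → Fin r → ℂ)
    (hM : IsSpectralSurface W E Lam π sheet lam e einv)
    (φ : Diffeomorph 𝓘(ℂ) 𝓘(ℂ) (OnePoint ℂ) M ⊤) :
    -- the scalar kernel exists, and is unique as a polynomial
    ∃ K : ℂ[X][X], IsScalarKernel φ π sheet e einv N R K ∧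
      (∀ K', IsScalarKernel φ π sheet e einv N R K' → K' = K) ∧
      -- every `f ∈ L_N` gives an element of `V`, and likewise for the dual spaces
      (∀ f ∈ meroSpace π e N, ∃ p ∈ polySpace φ π sheet e N,
        ∀ ζ ∈ regularPoints φ π e, p.eval ζ = f (φ ζ) * clearing φ sheet e N ζ) ∧
      (∀ f ∈ meroSpace π einv N, ∃ p ∈ polySpace φ π sheet einv N,
        ∀ ζ ∈ regularPoints φ π einv, p.eval ζ = f (φ ζ) * clearing φ sheet einv N ζ) ∧
      Module.finrank ℂ (polySpace φ π sheet e N) = r * N ∧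
      Module.finrank ℂ (polySpace φ π sheet einv N) = r * N ∧
      -- (a)
      (∀ u : ℂ, K.eval (Polynomial.C u) ∈ polySpace φ π sheet e N) ∧
      -- (b)
      (∀ ζ : ℂ, K.map (Polynomial.evalRingHom ζ) ∈ polySpace φ π sheet einv N) ∧
      ∀ lift : Fin n → Fin r → ℝ → M, IsLiftedContour π γ lift →
        -- (c)
        (∀ p ∈ polySpace φ π sheet e N, ∀ ζ : ℂ,
          (planeContour φ γ lift).HasIntegral
            (fun u => p.eval u * scalarWeight φ π sheet lam e einv N u *
              (K.eval (Polynomial.C u)).eval ζ)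
            (p.eval ζ)) ∧
        -- (d)
        (∀ p ∈ polySpace φ π sheet einv N, ∀ u : ℂ,
          (planeContour φ γ lift).HasIntegral
            (fun ζ => (K.eval (Polynomial.C u)).eval ζ * scalarWeight φ π sheet lam e einv N ζ *
              p.eval ζ)
            (p.eval u)) ∧
        -- (e)
        List.TFAE
          [-∑ᶠ p ∈ zerosPoles e, orderAt e p = (r : ℤ) - 1,
            -∑ᶠ p ∈ zerosPoles einv, orderAt einv p = (r : ℤ) - 1,
            polySpace φ π sheet e N = Polynomial.degreeLT ℂ (r * N),
            polySpace φ π sheet einv N = Polynomial.degreeLT ℂ (r * N),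
            IsCDKernel (planeContour φ γ lift)
              (fun u => Matrix.of fun _ _ : Unit => scalarWeight φ π sheet lam e einv N u)
                (r * N)
              (Matrix.of fun _ _ : Unit => K)] := by
  obtain ⟨A, B, hA, hB, hdeg, hAB⟩ := exists_polynomial_fraction φ hM.holomorphic
    (hM.sheets OnePoint.infty)
  obtain ⟨hne, hne'⟩ := hM.eventually_e_ne_zero φ
  obtain ⟨ε, hε0, hεle, hεD, hε⟩ := exists_polynomial_vector φ hM.meromorphic_e hne
  obtain ⟨ε', hε0', hεle', hεD', hε'⟩ := exists_polynomial_vector φ hM.meromorphic_einv hne'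
  obtain ⟨hb, hc⟩ := exists_representsBasis (N := N) hAB hε
  obtain ⟨hb', hc'⟩ := exists_representsBasis (N := N) hAB hε'
  have hreg := infinite_regularPoints (φ := φ) hM.holomorphic hM.sheets hM.meromorphic_e hne
  have hreg' := infinite_regularPoints (φ := φ) hM.holomorphic hM.sheets hM.meromorphic_einv hne'
  have hdual : Set.Infinite {z | ∃ x, IsDualFibre A B ε ε' z x} := by
    have h1 : ∀ᶠ z in Filter.cofinite, ∃ x, IsDualFibre A B ε ε' z x := by
      filter_upwards [hM.eventually_isGenericSpectralPoint φ] with z hz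
      exact ⟨_, hz.isDualFibre hM (fun w hw => ⟨(hAB w hw).1, (hAB w hw).2.1⟩) hε hε'⟩
    have := Set.Finite.infinite_compl (s := {z | ∃ x, IsDualFibre A B ε ε' z x}ᶜ) h1
    rwa [compl_compl] at this
  have hdual' : Set.Infinite {z | ∃ x, IsDualFibre A B ε' ε z x} :=
    hdual.mono fun z => Exists.imp fun x hx => hx.symm
  have hli := linearIndependent_homogenized N hdual
  have hli' := linearIndependent_homogenized N hdual'
  have hV := hb.polySpace_eq_span hreg
  have hV' := hb'.polySpace_eq_span hreg'
  have hcard : Fintype.card (Fin r × Fin N) = r * N := by simp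
  obtain ⟨hdet, hmom⟩ := hR.moments
  -- The point `φ ∞` lies in its own fibre, so at least one sheet exists.
  have hr : 0 < r := by
    obtain ⟨k, -⟩ := (hM.sheets _).exists_eq φ hM.holomorphic (p := φ OnePoint.infty) rfl
    exact k.pos
  have hrN : 0 < r * N := Nat.mul_pos hr hN
  have hVdeg : polySpace φ π sheet e N = Polynomial.degreeLT ℂ (r * N) ↔
      ∀ i, (ε i).natDegree < r := by
    rw [hV, ← hcard, span_eq_degreeLT_iff hli, hcard]
    simp only [mem_degreeLT_iff_natDegree_lt hrN]
    exact forall_homogenized_natDegree_lt_iff hN hA hB hdeg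
  have hVdeg' : polySpace φ π sheet einv N = Polynomial.degreeLT ℂ (r * N) ↔
      ∀ i, (ε' i).natDegree < r := by
    rw [hV', ← hcard, span_eq_degreeLT_iff hli', hcard]
    simp only [mem_degreeLT_iff_natDegree_lt hrN]
    exact forall_homogenized_natDegree_lt_iff hN hA hB hdeg
  have hK := isScalarKernel_bivariateKernel hb hb' hR.1
  refine ⟨bivariateKernel (kernelMatrix N R) (homogenized A B ε' N) (homogenized A B ε N), hK,
    fun K' hK' => hK.unique hreg hreg' hK', fun f hf => hb.exists_of_mem hf,
    fun f hf => hb'.exists_of_mem hf, by rw [hV, finrank_span_eq_card hli, hcard],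
    by rw [hV', finrank_span_eq_card hli', hcard], fun u => ?_, fun ζ => ?_, fun lift hlift => ?_⟩
  · rw [eval_bivariateKernel, hV]
    exact Submodule.sum_mem _ fun q _ => Submodule.smul_mem _ _ (Submodule.subset_span ⟨q, rfl⟩)
  · rw [map_bivariateKernel, hV']
    exact Submodule.sum_mem _ fun q _ => Submodule.smul_mem _ _ (Submodule.subset_span ⟨q, rfl⟩)
  have hint := fun p s => hasIntegral_scalarWeight hγ hM hlift hb hb' hc hc' (hmom p s)
  have hleft := fun p (hp : p ∈ polySpace φ π sheet e N) =>
    hasIntegral_mul_bivariateKernel hdet hint (hV ▸ hp)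
  have hright := fun p (hp : p ∈ polySpace φ π sheet einv N) =>
    hasIntegral_bivariateKernel_mul hdet hint (hV' ▸ hp)
  refine ⟨hleft, hright, ?_⟩
  tfae_have 1 ↔ 3 := (degree_eq_iff_forall_lt hdual hεle hεD).trans hVdeg.symm
  tfae_have 2 ↔ 4 := (degree_eq_iff_forall_lt hdual' hεle' hεD').trans hVdeg'.symm
  -- Both implications are the transfer of the degree bound to the dual vector, applied to `ε, ε'`
  -- and to `ε', ε`.
  tfae_have 3 ↔ 4 := hVdeg.trans (Iff.trans
    ⟨fun h => natDegree_lt_of_dual h hA hB hdual hε0',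
      fun h => natDegree_lt_of_dual h hA hB hdual' hε0⟩ hVdeg'.symm)
  tfae_have 3 → 5 := by
    intro h3
    have h4 := tfae_3_iff_4.1 h3
    have h5 := bivariateKernel_mem_degreeLT (A := kernelMatrix N R)
      (fun p => show homogenized A B ε' N p ∈ Polynomial.degreeLT ℂ (r * N) from
        h4.le (hV'.ge (Submodule.subset_span ⟨p, rfl⟩)))
      (fun p => show homogenized A B ε N p ∈ Polynomial.degreeLT ℂ (r * N) from
        h3.le (hV.ge (Submodule.subset_span ⟨p, rfl⟩)))
    refine ⟨fun _ _ => h5, Or.inl fun P hP ζ i j => ?_⟩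
    have h6 := hleft (P i j) (h3 ▸ hP i j) ζ
    convert h6 using 2
    simp [Matrix.mul_apply, evalKernel]
  -- Only the degree bound in the second variable is used; it forces the bound on each basis element
  -- of `V`.
  tfae_have 5 → 3 := by
    intro h5
    rw [hV, ← hcard, span_eq_degreeLT_iff hli, hcard]
    exact mem_degreeLT_of_coeff_bivariateKernel hdet hli' (h5.1 () ()).2
  tfae_finish
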